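/- Let $d\ge 1$. For a finite alphabet $A$, a nearest neighbor $\mathbb{Z}^d$ shift of finite type (SFT) over $A$ is a nonempty set $X\subseteq A^{\mathbb{Z}^d}$ of the form $$X=\{x : (x(v),x(v+e_i))\notin F_i \text{ for all } v\in\mathbb{Z}^d,\ 1\le i\le d\}$$ for some sets $F_1,\dots,F_d\subseteq A\times A$. Its topological entropy is $h(X)=\lim_{n_1,\dots,n_d\to\infty}\frac{1}{n_1\cdots n_d}\log|L_{n}(X)|$, where $L_n(X)$ is the set of restrictions of points of $X$ to $\prod_i[1,n_i]$. The entropy of a shift-invariant Borel probability measure $\mu$ on $A^{\mathbb{Z}^d}$ is $h(\mu)=\lim_{n_1,\dots,n_d\to\infty}\frac{-1}{n_1\cdots n_d}\sum_{w}\mu([w])\log\mu([w])$, the sum being over all $w\in A^{\prod_i[1,n_i]}$, where $[w]$ is the set of points that restrict to $w$ (and $0\log 0=0$). A measure of maximal entropy on $X$ is such a $\mu$ with $\mu(X)=1$ and $h(\mu)=h(X)$. Let $$\alpha_d=\inf\{\alpha\in\mathbb{R} : \text{there are a finite alphabet } A \text{ and a nearest neighbor } \mathbb{Z}^d \text{ SFT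 } X \text{ over } A \text{ with more than one measure of maximal entropy and } h(X)\ge \log|A|-\alpha\}.$$ Then $\alpha_1=\log 2$. More precisely: 1. If a nearest neighbor $\mathbb{Z}$ SFT $X$ over a finite alphabet $A$ has more than one measure of maximal entropy, then $X$ has at least two distinct irreducible components of entropy $h(X)$, and $\log|A|-h(X)\ge\log 2$. Here letters $a,b$ communicate if there are paths of positive length from $a$ to $b$ and from $b$ to $a$ in the directed graph on $A$ whose edges are the pairs of consecutive letters occurring in points of $X$, and an irreducible component is the set of all points of $X$ all of whose letters communicate with a given letter $a$ that communicates with itself. 2. For every $n\ge 1$, the union $X$ of two full shifts $A_1^{\mathbb{Z}}$ and $A_2^{\mathbb{Z}}$ with $|A_1|=|A_2|=n$, $A_1\cap A_2=\varnothing$, viewed over $A=A_1\sqcup A_2$, is a nearest neighbor $\mathbb{Z}$ SFT with more than one measure of maximal entropy, and $\log|A|-h(X)=\log 2$. -/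

import Mathlib

open Filter MeasureTheory

/-- The full shift `A^(ℤ^d)`. -/
def FullShift (d : ℕ) (A : Type) : Type := (Fin d → ℤ) → A

namespace FullShift

/-- The product of the discrete topologies. -/
instance instTopologicalSpace (d : ℕ) (A : Type) : TopologicalSpace (FullShift d A) :=
  @Pi.topologicalSpace (Fin d → ℤ) (fun _ => A) (fun _ => ⊥)

/-- The product of the discrete `σ`-algebras; for a finite alphabet it is the Borel `σ`-algebra,
see `instBorelSpace`. -/
instance instMeasurableSpace (d : ℕ) (A : Type) : MeasurableSpace (FullShift d A) :=
  @MeasurableSpace.pi (Fin d → ℤ) (fun _ => A) (fun _ => ⊤)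

instance instBorelSpace (d : ℕ) (A : Type) [Finite A] : BorelSpace (FullShift d A) := by
  let _ : TopologicalSpace A := ⊥
  let _ : MeasurableSpace A := ⊤
  have : DiscreteTopology A := ⟨rfl⟩
  have : BorelSpace A := ⟨borel_eq_top_of_discrete.symm⟩
  exact (inferInstance : BorelSpace ((Fin d → ℤ) → A))

/-- The shift action, `(σ_t x)(s) = x(s + t)`. -/
def shift {d : ℕ} {A : Type} (t : Fin d → ℤ) (x : FullShift d A) : FullShift d A :=
  fun s => x (s + t)

end FullShift

/-- `X` is a (nonempty) nearest neighbor `ℤ^d` shift of finite type over the alphabet `A`: for some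
sets `F i` of forbidden pairs of letters at sites `v` and `v + e_i`, it consists of all the
configurations in which no forbidden pair occurs. -/
def IsNearestNeighborSFT {d : ℕ} {A : Type} (X : Set (FullShift d A)) : Prop :=
  X.Nonempty ∧ ∃ F : Fin d → Set (A × A),
    X = {x | ∀ (i : Fin d) (v : Fin d → ℤ), (x v, x (v + Pi.single i 1)) ∉ F i}

/-- `L_S(X)`: the configurations of shape `S` that appear in points of `X`. -/
def languageOn {d : ℕ} {A : Type} (X : Set (FullShift d A)) (S : Finset (Fin d → ℤ)) :
    Set (S → A) :=
  {w | ∃ x ∈ X, ∀ s : S, x s = w s}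

/-- The cylinder set `[w]` of a configuration `w` of shape `S`, in the full shift. -/
def cylinderSet {d : ℕ} {A : Type} {S : Finset (Fin d → ℤ)} (w : S → A) : Set (FullShift d A) :=
  {x | ∀ s : S, x s = w s}

/-- The box `[1, n_1] × ⋯ × [1, n_d]`. -/
noncomputable def box {d : ℕ} (n : Fin d → ℕ) : Finset (Fin d → ℤ) :=
  Fintype.piFinset fun i => Finset.Icc (1 : ℤ) (n i)

/-- Topological entropy: the limit of `log |L_{box n}(X)| / ∏ n_i` as all `n_i → ∞`
(`atTop` on `Fin d → ℕ` is taken for the coordinatewise order). -/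
noncomputable def topologicalEntropy {d : ℕ} {A : Type} (X : Set (FullShift d A)) : ℝ :=
  limUnder atTop fun n : Fin d → ℕ =>
    Real.log ((languageOn X (box n)).ncard : ℝ) / ∏ i, (n i : ℝ)

/-- Measure-theoretic entropy: the limit of `(-∑_w μ[w] log μ[w]) / ∏ n_i` as all `n_i → ∞`,
`w` running over the configurations of shape `box n`. -/
noncomputable def measureEntropy {d : ℕ} {A : Type} [Fintype A] (μ : Measure (FullShift d A)) :
    ℝ :=
  limUnder atTop fun n : Fin d → ℕ =>
    (∑ w : box n → A, Real.negMulLog (μ.real (cylinderSet w))) / ∏ i, (n i : ℝ)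

/-- The measures of maximal entropy on `X`: the shift-invariant Borel probability measures
supported in `X` whose entropy is that of `X`. -/
structure IsMeasureOfMaximalEntropy {d : ℕ} {A : Type} [Fintype A] (X : Set (FullShift d A))
    (μ : Measure (FullShift d A)) : Prop where
  isProbabilityMeasure : IsProbabilityMeasure μ
  invariant : ∀ t : Fin d → ℤ, MeasurePreserving (FullShift.shift t) μ μ
  supported : μ Xᶜ = 0
  entropy_eq : measureEntropy μ = topologicalEntropy X

/-- `X` has more than one measure of maximal entropy. -/
def HasMultipleMME {d : ℕ} {A : Type} [Fintype A] (X : Set (FullShift d A)) : Prop :=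
  ∃ μ ν : Measure (FullShift d A),
    IsMeasureOfMaximalEntropy X μ ∧ IsMeasureOfMaximalEntropy X ν ∧ μ ≠ ν

/-- `α_d`: the infimum of all `α` for which some nearest neighbor `ℤ^d` SFT `X`, over some finite
alphabet `A`, has more than one measure of maximal entropy and `h(X) ≥ log |A| - α`. -/
noncomputable def alphaCrit (d : ℕ) : ℝ :=
  sInf {α : ℝ | ∃ (A : Type) (_ : Fintype A) (X : Set (FullShift d A)),
    IsNearestNeighborSFT X ∧ HasMultipleMME X ∧
      topologicalEntropy X ≥ Real.log (Fintype.card A) - α}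

/-- The letter `b` follows the letter `a` in some point of the `ℤ` subshift `X`. -/
def Follows {A : Type} (X : Set (FullShift 1 A)) (a b : A) : Prop :=
  ∃ x ∈ X, ∃ v : Fin 1 → ℤ, x v = a ∧ x (v + Pi.single 0 1) = b

/-- There are paths (with at least one step) from `a` to `b` and from `b` to `a` in the graph of
the relation `Follows X`. -/
def Communicates {A : Type} (X : Set (FullShift 1 A)) (a b : A) : Prop :=
  Relation.TransGen (Follows X) a b ∧ Relation.TransGen (Follows X) b a

/-- `Y` is an irreducible component of the nearest neighbor `ℤ` SFT `X`: the set of the points of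
`X` all of whose letters lie in one communicating class, that of a letter `a` which communicates
with itself (so that `Y` is nonempty). -/
def IsIrreducibleComponent {A : Type} (X Y : Set (FullShift 1 A)) : Prop :=
  ∃ a : A, Communicates X a a ∧ Y = {x ∈ X | ∀ v, Communicates X a (x v)}

/-- The union of two disjoint full `ℤ` shifts on `n` symbols each; its alphabet is the disjoint
union `Fin n ⊕ Fin n`. -/
def twoFullShifts (n : ℕ) : Set (FullShift 1 (Fin n ⊕ Fin n)) :=
  {x | ∀ v, ∃ a : Fin n, x v = Sum.inl a} ∪ {x | ∀ v, ∃ a : Fin n, x v = Sum.inr a}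

/-!
Let `λ(a)` be the Perron eigenvalue of the communicating class of `a` in the graph of the edges that
lie on cycles. Gibbs' inequality against the Parry transition matrix, built from the Perron
eigenvectors of the classes, bounds the entropy of an invariant measure `μ` by `∑ a, μ[a] log λ(a)`.
If `μ` has maximal entropy there is equality: `μ` is Markov with the Parry transitions, and it
charges only letters of classes of maximal entropy. A single such class carries only one stationary
vector, so two measures of maximal entropy require two irreducible components of maximal entropy.
Their alphabets are disjoint, so that `2 exp h(X) ≤ |A|`. Equality holds for the union of two full
shifts, where the two uniform Bernoulli measures have maximal entropy.
-/

open Relation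
open scoped Matrix

section RecurrentEdges

variable {α : Type*} {E : α → α → Prop}

/-- Mutual reachability in a graph each of whose edges can be traversed back along some path. -/
def reachabilitySetoid (hE : ∀ a b, E a b → ReflTransGen E b a) :
    Setoid α where
  r := ReflTransGen E
  iseqv :=
    { refl := fun _ => .refl
      symm := fun h => by
        induction h with
        | refl => exact .refl
        | tail _ hbc ih => exact (hE _ _ hbc).trans ih
      trans := .trans }

theorem reflTransGen_within_class (hE : ∀ a b, E a b → ReflTransGen E b a)
    {C : Quotient (reachabilitySetoid hE)} {a b : α} (hab : ReflTransGen E a b)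
    (ha : ⟦a⟧ = C) (hb : ⟦b⟧ = C) :
    ReflTransGen (fun i j : {c // ⟦c⟧ = C} => E i j) ⟨a, ha⟩ ⟨b, hb⟩ := by
  induction hab with
  | refl => exact .refl
  | @tail b c hab hbc ih =>
    have hb' : ⟦b⟧ = C := by rw [← ha]; exact (Quotient.sound hab).symm
    exact (ih hb').tail hbc

/-- The edges of a graph that lie on a cycle. They are the edges inside the communicating classes,
and are the only ones used by stationary processes on the graph. -/
def RecurrentEdge (E : α → α → Prop) (a b : α) : Prop :=
  E a b ∧ ReflTransGen E b a

theorem reflTransGen_recurrentEdge_of_cycle {a b : α} (hab : ReflTransGen E a b)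
    (hba : ReflTransGen E b a) : ReflTransGen (RecurrentEdge E) a b := by
  induction hab with
  | refl => exact .refl
  | tail hab hbc ih => exact (ih (hba.head hbc)).tail ⟨hbc, hba.trans hab⟩

theorem reflTransGen_recurrentEdge_symm {a b : α} (hab : RecurrentEdge E a b) :
    ReflTransGen (RecurrentEdge E) b a :=
  reflTransGen_recurrentEdge_of_cycle hab.2 (.single hab.1)

theorem transGen_recurrentEdge_iff {a b : α} :
    TransGen (RecurrentEdge E) a b ↔ TransGen E a b ∧ TransGen E b a := by
  constructor
  · have reverse {c d : α} (h : RecurrentEdge E c d) : TransGen E d c :=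
      (TransGen.tail' h.2 h.1).trans_left h.2
    intro h
    induction h with
    | single h => exact ⟨.single h.1, reverse h⟩
    | tail _ hbc ih => exact ⟨ih.1.tail hbc.1, (reverse hbc).trans ih.2⟩
  · rintro ⟨hab, hba⟩
    obtain ⟨c, hac, hcb⟩ := TransGen.head'_iff.1 hab
    have hca := hcb.trans hba.to_reflTransGen
    exact .head' ⟨hac, hca⟩ (reflTransGen_recurrentEdge_of_cycle hcb (hba.to_reflTransGen.tail hac))

end RecurrentEdges

section NonnegativeMatrix

variable {ι : Type*}

theorem exists_pos_smul_le_of_pos [Finite ι] (x : ι → ℝ) {y : ι → ℝ} (hy : ∀ i, 0 < y i) :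
    ∃ ε : ℝ, 0 < ε ∧ ε • x ≤ y := by
  have hev (i : ι) : ∀ᶠ ε : ℝ in nhdsWithin 0 (Set.Ioi 0), ε * x i ≤ y i := by
    have h : Tendsto (fun ε : ℝ => ε * x i) (nhds 0) (nhds (0 * x i)) :=
      tendsto_id.mul_const (x i)
    rw [zero_mul] at h
    exact ((h.mono_left nhdsWithin_le_nhds).eventually_lt_const (hy i)).mono fun _ => le_of_lt
  obtain ⟨ε, hle, hε⟩ := ((eventually_all.2 hev).and self_mem_nhdsWithin).exists
  exact ⟨ε, hε, hle⟩

variable [Fintype ι] {M : Matrix ι ι ℝ}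

theorem mulVec_nonneg_of_nonneg (hM : ∀ a b, 0 ≤ M a b) {x : ι → ℝ} (hx : 0 ≤ x) :
    0 ≤ M *ᵥ x :=
  fun a => Finset.sum_nonneg fun b _ => mul_nonneg (hM a b) (hx b)

theorem mulVec_pos_of_pos (hM : ∀ a b, 0 < M a b) {x : ι → ℝ} (hx : 0 ≤ x) (hx0 : x ≠ 0) (a : ι) :
    0 < (M *ᵥ x) a := by
  obtain ⟨b, hb⟩ := Function.ne_iff.1 hx0
  exact Finset.sum_pos' (fun c _ => mul_nonneg (hM a c).le (hx c))
    ⟨b, Finset.mem_univ b, mul_pos (hM a b) ((hx b).lt_of_ne' hb)⟩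

theorem pos_of_mulVec_le_smul (hM : ∀ a b, 0 ≤ M a b) {x : ι → ℝ} {t : ℝ} (hx : 0 ≤ x)
    (hMx : M *ᵥ x ≤ t • x) {a b : ι} (hab : ReflTransGen (fun i j => 0 < M i j) a b)
    (hb : 0 < x b) : 0 < x a := by
  induction hab using ReflTransGen.head_induction_on with
  | refl => exact hb
  | @head a c hac _ hc =>
    refine (hx a).lt_of_ne' fun ha => ?_
    have hpos : 0 < (M *ᵥ x) a :=
      Finset.sum_pos' (fun d _ => mul_nonneg (hM a d) (hx d)) ⟨c, Finset.mem_univ c, mul_pos hac hc⟩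
    have hle : (M *ᵥ x) a ≤ t * x a := hMx a
    rw [ha, Pi.zero_apply, mul_zero] at hle
    exact hpos.not_ge hle

theorem exists_pow_apply_pos_of_reflTransGen [DecidableEq ι] (hM : ∀ a b, 0 ≤ M a b) {a b : ι}
    (hab : ReflTransGen (fun i j => 0 < M i j) a b) : ∃ k, 0 < (M ^ k) a b := by
  induction hab with
  | refl => exact ⟨0, by simp⟩
  | @tail b c _ hbc ih =>
    obtain ⟨k, hk⟩ := ih
    refine ⟨k + 1, ?_⟩
    rw [pow_succ, Matrix.mul_apply]
    exact Finset.sum_pos' (fun d _ => mul_nonneg (Matrix.pow_apply_nonneg hM k a d) (hM d c))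
      ⟨b, Finset.mem_univ b, mul_pos hk hbc⟩

theorem exists_commute_pos_of_irreducible (hM : ∀ a b, 0 ≤ M a b)
    (hirr : ∀ a b, ReflTransGen (fun i j => 0 < M i j) a b) :
    ∃ B : Matrix ι ι ℝ, Commute M B ∧ ∀ a b, 0 < B a b := by
  classical
  choose k hk using fun a b => exists_pow_apply_pos_of_reflTransGen hM (hirr a b)
  refine ⟨∑ ij : ι × ι, M ^ k ij.1 ij.2,
    Commute.sum_right _ _ _ fun ij _ => Commute.self_pow M _, fun a b => ?_⟩
  rw [Matrix.sum_apply]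
  exact Finset.sum_pos' (fun ij _ => Matrix.pow_apply_nonneg hM _ a b)
    ⟨(a, b), Finset.mem_univ _, hk a b⟩

/-- The `s ≥ 0` admitting an `s`-subinvariant nonnegative vector. For an irreducible nonnegative
matrix the least of them is the Perron eigenvalue. -/
def subinvariantValues (M : Matrix ι ι ℝ) : Set ℝ :=
  {s | 0 ≤ s ∧ ∃ x : ι → ℝ, 0 ≤ x ∧ x ≠ 0 ∧ M *ᵥ x ≤ s • x}

theorem subinvariantValues_nonempty [Nonempty ι] (hM : ∀ a b, 0 ≤ M a b) :
    (subinvariantValues M).Nonempty := by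
  refine ⟨∑ a, ∑ b, M a b, Finset.sum_nonneg fun a _ => Finset.sum_nonneg fun b _ => hM a b,
    1, zero_le_one, one_ne_zero, fun a => ?_⟩
  simp only [Matrix.mulVec, dotProduct, Pi.smul_apply, Pi.one_apply, smul_eq_mul, mul_one]
  exact Finset.single_le_sum (f := fun a => ∑ b, M a b)
    (fun a _ => Finset.sum_nonneg fun b _ => hM a b) (Finset.mem_univ a)

theorem exists_mem_stdSimplex_of_mem_subinvariantValues {s : ℝ} (hs : s ∈ subinvariantValues M) :
    ∃ x ∈ stdSimplex ℝ ι, M *ᵥ x ≤ s • x := by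
  obtain ⟨-, x, hx, hx0, hMx⟩ := hs
  obtain ⟨b, hb⟩ := Function.ne_iff.1 hx0
  have hsum : 0 < ∑ a, x a :=
    Finset.sum_pos' (fun a _ => hx a) ⟨b, Finset.mem_univ b, (hx b).lt_of_ne' hb⟩
  have hinv : 0 ≤ (∑ a, x a)⁻¹ := inv_nonneg.2 hsum.le
  refine ⟨(∑ a, x a)⁻¹ • x, ⟨fun a => mul_nonneg hinv (hx a), ?_⟩, ?_⟩
  · simp only [Pi.smul_apply, smul_eq_mul, ← Finset.mul_sum]
    exact inv_mul_cancel₀ hsum.ne'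
  · rw [Matrix.mulVec_smul, smul_comm]
    exact smul_le_smul_of_nonneg_left hMx hinv

theorem ne_zero_of_mem_stdSimplex {x : ι → ℝ} (hx : x ∈ stdSimplex ℝ ι) : x ≠ 0 := by
  rintro rfl
  simpa using hx.2

theorem exists_isLeast_subinvariantValues [Nonempty ι] (hM : ∀ a b, 0 ≤ M a b) :
    ∃ t, IsLeast (subinvariantValues M) t := by
  obtain ⟨c, hc⟩ := subinvariantValues_nonempty hM
  obtain ⟨y, hy, hMy⟩ := exists_mem_stdSimplex_of_mem_subinvariantValues hc
  let K : Set (ℝ × (ι → ℝ)) := (Set.Icc 0 c ×ˢ stdSimplex ℝ ι) ∩ {z | M *ᵥ z.2 ≤ z.1 • z.2}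
  have hK : IsCompact K := by
    refine (isCompact_Icc.prod (isCompact_stdSimplex ℝ ι)).inter_right
      (isClosed_le ?_ (by fun_prop))
    exact continuous_const.matrix_mulVec continuous_snd
  obtain ⟨⟨t, x⟩, ⟨⟨ht, hx⟩, hMx⟩, hmin⟩ :=
    hK.exists_isMinOn ⟨(c, y), ⟨⟨hc.1, le_rfl⟩, hy⟩, hMy⟩ continuous_fst.continuousOn
  refine ⟨t, ⟨ht.1, x, hx.1, ne_zero_of_mem_stdSimplex hx, hMx⟩, fun s hs => ?_⟩
  obtain ⟨z, hz, hMz⟩ := exists_mem_stdSimplex_of_mem_subinvariantValues hs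
  rcases le_total s c with hsc | hcs
  · exact hmin (show (s, z) ∈ K from ⟨⟨⟨hs.1, hsc⟩, hz⟩, hMz⟩)
  · exact ht.2.trans hcs

theorem mulVec_eq_smul_of_isLeast_subinvariantValues (hM : ∀ a b, 0 ≤ M a b)
    (hirr : ∀ a b, ReflTransGen (fun i j => 0 < M i j) a b) {t : ℝ}
    (ht : IsLeast (subinvariantValues M) t) {x : ι → ℝ} (hx : 0 ≤ x) (hx0 : x ≠ 0)
    (hMx : M *ᵥ x ≤ t • x) : M *ᵥ x = t • x := by
  obtain ⟨B, hMB, hB⟩ := exists_commute_pos_of_irreducible hM hirr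
  by_contra hne
  have hBx := mulVec_pos_of_pos hB hx hx0
  -- Applying `B` makes the subinvariance strict in every coordinate, so that `t` can be lowered.
  have hBv := mulVec_pos_of_pos hB (sub_nonneg.2 hMx) (sub_ne_zero.2 (Ne.symm hne))
  obtain ⟨ε, hε, hle⟩ := exists_pos_smul_le_of_pos (B *ᵥ x) hBv
  have hsub : M *ᵥ (B *ᵥ x) ≤ (t - ε) • (B *ᵥ x) := by
    rw [Matrix.mulVec_sub, Matrix.mulVec_smul, Matrix.mulVec_mulVec, ← hMB.eq,
      ← Matrix.mulVec_mulVec] at hle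
    rw [sub_smul]
    exact le_sub_comm.1 hle
  have hnonneg : 0 ≤ t - ε := by
    obtain ⟨a, -⟩ := Function.ne_iff.1 hx0
    have h : (M *ᵥ (B *ᵥ x)) a ≤ (t - ε) * (B *ᵥ x) a := hsub a
    exact nonneg_of_mul_nonneg_left
      ((mulVec_nonneg_of_nonneg hM (fun c => (hBx c).le) a).trans h) (hBx a)
  have hBx0 : B *ᵥ x ≠ 0 := by
    obtain ⟨a, -⟩ := Function.ne_iff.1 hx0
    exact fun h => (hBx a).ne' (congrFun h a)
  have := ht.2 ⟨hnonneg, B *ᵥ x, fun c => (hBx c).le, hBx0, hsub⟩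
  linarith

theorem exists_pos_eigenvector_of_irreducible [Nonempty ι] (hM : ∀ a b, 0 ≤ M a b)
    (hirr : ∀ a b, ReflTransGen (fun i j => 0 < M i j) a b) :
    ∃ (t : ℝ) (x : ι → ℝ), (∀ a, 0 < x a) ∧ M *ᵥ x = t • x := by
  obtain ⟨t, ht⟩ := exists_isLeast_subinvariantValues hM
  obtain ⟨-, x, hx, hx0, hMx⟩ := ht.1
  obtain ⟨b, hb⟩ := Function.ne_iff.1 hx0
  exact ⟨t, x, fun a => pos_of_mulVec_le_smul hM hx hMx (hirr a b) ((hx b).lt_of_ne' hb),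
    mulVec_eq_smul_of_isLeast_subinvariantValues hM hirr ht hx hx0 hMx⟩

theorem eq_of_mulVec_eq_smul_of_mem_stdSimplex (hM : ∀ a b, 0 ≤ M a b) {S : Set ι}
    (hS : ∀ a ∈ S, ∀ b ∈ S, ReflTransGen (fun i j => 0 < M i j) a b) {t : ℝ} {x y : ι → ℝ}
    (hx : x ∈ stdSimplex ℝ ι) (hy : y ∈ stdSimplex ℝ ι) (hxS : ∀ a ∉ S, x a = 0)
    (hyS : ∀ a ∉ S, y a = 0) (hMx : M *ᵥ x = t • x) (hMy : M *ᵥ y = t • y) : x = y := by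
  obtain ⟨b, hb⟩ := Function.ne_iff.1 (ne_zero_of_mem_stdSimplex hx)
  have hbS : b ∈ S := by_contra fun h => hb (hxS b h)
  have hxpos (a : ι) (ha : a ∈ S) : 0 < x a :=
    pos_of_mulVec_le_smul hM hx.1 hMx.le (hS a ha b hbS) ((hx.1 b).lt_of_ne' hb)
  obtain ⟨a, ha, hmin⟩ := S.toFinite.exists_minimalFor (fun a => y a / x a) S ⟨b, hbS⟩
  set c := y a / x a
  have hz : 0 ≤ y - c • x := by
    intro d
    by_cases hd : d ∈ S
    · have h : c ≤ y d / x d := le_of_not_gt fun h => h.not_ge (hmin hd h.le)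
      exact sub_nonneg.2 ((le_div_iff₀ (hxpos d hd)).1 h)
    · simp [hxS d hd, hyS d hd]
  have hMz : M *ᵥ (y - c • x) = t • (y - c • x) := by
    rw [Matrix.mulVec_sub, Matrix.mulVec_smul, hMx, hMy, smul_sub, smul_comm c t]
  have hza : (y - c • x) a = 0 := sub_eq_zero.2 (div_mul_cancel₀ (y a) (hxpos a ha).ne').symm
  have hyx (d : ι) : y d = c * x d := by
    by_cases hd : d ∈ S
    · refine sub_eq_zero.1 (not_not.1 fun h => ?_)
      exact (pos_of_mulVec_le_smul hM hz hMz.le (hS a ha d hd) ((hz d).lt_of_ne' h)).ne' hza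
    · rw [hxS d hd, hyS d hd, mul_zero]
  have hc : c = 1 := by
    have hsum := hy.2
    rwa [Finset.sum_congr rfl fun d _ => hyx d, ← Finset.mul_sum, hx.2, mul_one] at hsum
  exact funext fun d => by rw [hyx d, hc, one_mul]

/-- `r` is positive and `M r = lam r`, where `lam` is constant along the edges of `M`: on every
component of the graph of `M`, `r` is a Perron eigenvector. -/
structure IsPerronPair (M : Matrix ι ι ℝ) (lam r : ι → ℝ) : Prop where
  pos : ∀ a, 0 < r a
  lam_eq : ∀ a b, 0 < M a b → lam a = lam b
  mulVec_eq : M *ᵥ r = lam * r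

theorem exists_isPerronPair (hM : ∀ a b, 0 ≤ M a b)
    (hsymm : ∀ a b, 0 < M a b → ReflTransGen (fun i j => 0 < M i j) b a) :
    ∃ lam r : ι → ℝ, IsPerronPair M lam r := by
  classical
  let cls (a : ι) : Quotient (reachabilitySetoid hsymm) := ⟦a⟧
  have hcls {a b : ι} (hab : 0 < M a b) : cls b = cls a :=
    (Quotient.sound (show ReflTransGen (fun i j => 0 < M i j) a b from .single hab)).symm
  have hclass (C : Quotient (reachabilitySetoid hsymm)) : ∃ (t : ℝ) (x : {c // cls c = C} → ℝ),
      (∀ c, 0 < x c) ∧ M.submatrix (↑) (↑) *ᵥ x = t • x := by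
    have : Nonempty {c // cls c = C} := (Quotient.exists_rep C).elim fun a ha => ⟨a, ha⟩
    exact exists_pos_eigenvector_of_irreducible (fun a b => hM a b) fun a b =>
      reflTransGen_within_class hsymm (Quotient.exact (a.2.trans b.2.symm)) a.2 b.2
  choose t x hx hMx using hclass
  refine ⟨fun a => t (cls a), fun a => x (cls a) ⟨a, rfl⟩, fun a => hx _ _,
    fun a b hab => by rw [hcls hab], funext fun a => ?_⟩
  have hout (b : ι) (hb : ¬cls b = cls a) : M a b = 0 :=
    (hM a b).antisymm' (not_lt.1 fun hab => hb (hcls hab))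
  have hin (b : {c // cls c = cls a}) : x (cls b) ⟨b, rfl⟩ = x (cls a) b := by
    obtain ⟨b, hb⟩ := b
    congr!
  calc ∑ b, M a b * x (cls b) ⟨b, rfl⟩
      = ∑ b : {c // cls c = cls a}, M a b * x (cls b) ⟨b, rfl⟩ := by
        rw [← Fintype.sum_subtype_add_sum_subtype (fun b => cls b = cls a)]
        exact add_eq_left.2 (Fintype.sum_eq_zero _ fun b => by rw [hout b b.2, zero_mul])
    _ = ∑ b : {c // cls c = cls a}, M a b * x (cls a) b := by simp only [hin]
    _ = t (cls a) * x (cls a) ⟨a, rfl⟩ := congrFun (hMx (cls a)) ⟨a, rfl⟩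

end NonnegativeMatrix

section Gibbs

variable {ι : Type*} [Fintype ι] {q x : ι → ℝ}

theorem mul_klFun_div {s t : ℝ} (hst : s ≠ 0 → t ≠ 0) :
    t * InformationTheory.klFun (s / t) = s * -Real.log t - Real.negMulLog s + (t - s) := by
  rcases eq_or_ne s 0 with rfl | hs
  · simp [InformationTheory.klFun_zero]
  · have ht := hst hs
    rw [InformationTheory.klFun, Real.log_div hs ht, Real.negMulLog]
    field_simp
    ring

theorem sum_negMulLog_le (hq : ∀ i, 0 ≤ q i) (hx : ∀ i, 0 ≤ x i) (hqx : ∀ i, q i ≠ 0 → x i ≠ 0)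
    (hsum : ∑ i, x i ≤ ∑ i, q i) :
    ∑ i, Real.negMulLog (q i) ≤ ∑ i, q i * -Real.log (x i) := by
  have hkl : 0 ≤ ∑ i, x i * InformationTheory.klFun (q i / x i) :=
    Finset.sum_nonneg fun i _ =>
      mul_nonneg (hx i) (InformationTheory.klFun_nonneg (div_nonneg (hq i) (hx i)))
  simp only [mul_klFun_div (hqx _), Finset.sum_add_distrib, Finset.sum_sub_distrib] at hkl
  linarith

theorem eq_of_sum_mul_neg_log_le (hq : ∀ i, 0 ≤ q i) (hx : ∀ i, 0 ≤ x i)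
    (hqx : ∀ i, q i ≠ 0 → x i ≠ 0) (hsum : ∑ i, x i ≤ ∑ i, q i)
    (hle : ∑ i, q i * -Real.log (x i) ≤ ∑ i, Real.negMulLog (q i)) (i : ι) : q i = x i := by
  have hnonneg (i : ι) : 0 ≤ x i * InformationTheory.klFun (q i / x i) :=
    mul_nonneg (hx i) (InformationTheory.klFun_nonneg (div_nonneg (hq i) (hx i)))
  have hkl : ∑ i, x i * InformationTheory.klFun (q i / x i) ≤ 0 := by
    simp only [mul_klFun_div (hqx _), Finset.sum_add_distrib, Finset.sum_sub_distrib]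
    linarith
  have hi := (Finset.sum_eq_zero_iff_of_nonneg fun i _ => hnonneg i).1
    (hkl.antisymm (Finset.sum_nonneg fun i _ => hnonneg i)) i (Finset.mem_univ i)
  rcases mul_eq_zero.1 hi with hxi | hkli
  · rw [hxi]
    exact not_not.1 fun h => hqx i h hxi
  · exact (eq_of_div_eq_one
      ((InformationTheory.klFun_eq_zero_iff (div_nonneg (hq i) (hx i))).1 hkli))

end Gibbs

section Words

variable {A M : Type*} [Fintype A] [AddCommMonoid M] {n : ℕ}

theorem sum_eq_sum_snoc (f : (Fin (n + 1) → A) → M) :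
    ∑ w, f w = ∑ w, ∑ b, f (Fin.snoc w b) := by
  rw [← (Fin.snocEquiv fun _ : Fin (n + 1) => A).sum_comp, Fintype.sum_prod_type_right]
  rfl

theorem sum_eq_sum_cons (f : (Fin (n + 1) → A) → M) :
    ∑ w, f w = ∑ w, ∑ a, f (Fin.cons a w) := by
  rw [← (Fin.consEquiv fun _ : Fin (n + 1) => A).sum_comp, Fintype.sum_prod_type_right]
  rfl

end Words

/-- The laws of the blocks of a stationary process with values in a finite alphabet. -/
structure StationaryLaw (A : Type*) [Fintype A] where
  prob : (n : ℕ) → (Fin n → A) → ℝ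
  nonneg : ∀ n w, 0 ≤ prob n w
  prob_zero : ∀ w, prob 0 w = 1
  sum_snoc : ∀ n w, ∑ b, prob (n + 1) (Fin.snoc w b) = prob n w
  sum_cons : ∀ n w, ∑ a, prob (n + 1) (Fin.cons a w) = prob n w

namespace StationaryLaw

variable {A : Type*} [Fintype A] (p : StationaryLaw A) {n : ℕ}

theorem prob_le_prob_init (w : Fin (n + 1) → A) : p.prob (n + 1) w ≤ p.prob n (Fin.init w) := by
  rw [← p.sum_snoc n]
  nth_rw 1 [← Fin.snoc_init_self w]
  exact Finset.single_le_sum (f := fun b => p.prob (n + 1) (Fin.snoc (Fin.init w) b))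
    (fun b _ => p.nonneg _ _) (Finset.mem_univ (w (Fin.last n)))

theorem prob_le_prob_tail (w : Fin (n + 1) → A) : p.prob (n + 1) w ≤ p.prob n (Fin.tail w) := by
  rw [← p.sum_cons n]
  nth_rw 1 [← Fin.cons_self_tail w]
  exact Finset.single_le_sum (f := fun a => p.prob (n + 1) (Fin.cons a (Fin.tail w)))
    (fun a _ => p.nonneg _ _) (Finset.mem_univ (w 0))

theorem sum_prob_mul_init (f : (Fin n → A) → ℝ) :
    ∑ w, p.prob (n + 1) w * f (Fin.init w) = ∑ w, p.prob n w * f w := by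
  simp only [sum_eq_sum_snoc, Fin.init_snoc, ← Finset.sum_mul, p.sum_snoc]

theorem sum_prob_mul_tail (f : (Fin n → A) → ℝ) :
    ∑ w, p.prob (n + 1) w * f (Fin.tail w) = ∑ w, p.prob n w * f w := by
  simp only [sum_eq_sum_cons, Fin.tail_cons, ← Finset.sum_mul, p.sum_cons]

/-- The entropy of the blocks of length `n`. -/
noncomputable def blockEntropy (n : ℕ) : ℝ := ∑ w, Real.negMulLog (p.prob n w)

/-- The entropy of a letter, conditionally on the `n` letters before it. -/
noncomputable def condEntropy (n : ℕ) : ℝ := p.blockEntropy (n + 1) - p.blockEntropy n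

/-- A family of transition probabilities to the last letter of a word of length `n + 1` from the
other letters, of total mass at most one and charging the transitions of the process. -/
structure IsTransitionKernel (R : (Fin (n + 1) → A) → ℝ) : Prop where
  nonneg : ∀ w, 0 ≤ R w
  sum_le_one : ∀ w : Fin n → A, ∑ b, R (Fin.snoc w b) ≤ 1
  ne_zero : ∀ w, p.prob (n + 1) w ≠ 0 → R w ≠ 0

variable {p} {R : (Fin (n + 1) → A) → ℝ}

theorem prob_init_ne_zero {w : Fin (n + 1) → A} (hw : p.prob (n + 1) w ≠ 0) :
    p.prob n (Fin.init w) ≠ 0 :=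
  fun h => hw ((h ▸ p.prob_le_prob_init w).antisymm (p.nonneg _ _))

theorem prob_tail_ne_zero {w : Fin (n + 1) → A} (hw : p.prob (n + 1) w ≠ 0) :
    p.prob n (Fin.tail w) ≠ 0 :=
  fun h => hw ((h ▸ p.prob_le_prob_tail w).antisymm (p.nonneg _ _))

theorem sum_prob_mul_neg_log_init_mul (hR : ∀ w, p.prob (n + 1) w ≠ 0 → R w ≠ 0) :
    ∑ w, p.prob (n + 1) w * -Real.log (p.prob n (Fin.init w) * R w) =
      p.blockEntropy n + ∑ w, p.prob (n + 1) w * -Real.log (R w) := by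
  have hlog (w : Fin (n + 1) → A) :
      p.prob (n + 1) w * -Real.log (p.prob n (Fin.init w) * R w) =
        p.prob (n + 1) w * -Real.log (p.prob n (Fin.init w)) +
          p.prob (n + 1) w * -Real.log (R w) := by
    rcases eq_or_ne (p.prob (n + 1) w) 0 with h | h
    · simp [h]
    · rw [Real.log_mul (prob_init_ne_zero h) (hR w h)]
      ring
  simp only [hlog, Finset.sum_add_distrib, blockEntropy, Real.negMulLog, neg_mul_comm]
  rw [p.sum_prob_mul_init fun w => -Real.log (p.prob n w)]

namespace IsTransitionKernel

theorem sum_prob_init_mul_le (hR : p.IsTransitionKernel R) :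
    ∑ w, p.prob n (Fin.init w) * R w ≤ ∑ w, p.prob (n + 1) w := by
  simp only [sum_eq_sum_snoc, Fin.init_snoc, ← Finset.mul_sum, p.sum_snoc]
  exact Finset.sum_le_sum fun w _ => mul_le_of_le_one_right (p.nonneg n w) (hR.sum_le_one w)

theorem condEntropy_le (hR : p.IsTransitionKernel R) :
    p.condEntropy n ≤ ∑ w, p.prob (n + 1) w * -Real.log (R w) := by
  rw [condEntropy, sub_le_iff_le_add', ← sum_prob_mul_neg_log_init_mul hR.ne_zero]
  exact sum_negMulLog_le (p.nonneg _) (fun w => mul_nonneg (p.nonneg _ _) (hR.nonneg w))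
    (fun w hw => mul_ne_zero (prob_init_ne_zero hw) (hR.ne_zero w hw)) hR.sum_prob_init_mul_le

theorem prob_eq_of_le_condEntropy (hR : p.IsTransitionKernel R)
    (hle : ∑ w, p.prob (n + 1) w * -Real.log (R w) ≤ p.condEntropy n) (w : Fin (n + 1) → A) :
    p.prob (n + 1) w = p.prob n (Fin.init w) * R w := by
  rw [condEntropy, le_sub_iff_add_le', ← sum_prob_mul_neg_log_init_mul hR.ne_zero] at hle
  exact eq_of_sum_mul_neg_log_le (p.nonneg _) (fun w => mul_nonneg (p.nonneg _ _) (hR.nonneg w))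
    (fun w hw => mul_ne_zero (prob_init_ne_zero hw) (hR.ne_zero w hw)) hR.sum_prob_init_mul_le
    hle w

end IsTransitionKernel

variable (p)

theorem condEntropy_eq_sum_neg_log (n : ℕ) :
    p.condEntropy n =
      ∑ w, p.prob (n + 1) w * -Real.log (p.prob (n + 1) w / p.prob n (Fin.init w)) := by
  rw [condEntropy, sub_eq_iff_eq_add',
    ← sum_prob_mul_neg_log_init_mul fun w hw => div_ne_zero hw (prob_init_ne_zero hw), blockEntropy]
  refine Finset.sum_congr rfl fun w _ => ?_
  rcases eq_or_ne (p.prob (n + 1) w) 0 with h | h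
  · simp [h]
  · rw [mul_div_cancel₀ _ (prob_init_ne_zero h), Real.negMulLog, neg_mul_comm]

theorem condEntropy_nonneg (n : ℕ) : 0 ≤ p.condEntropy n := by
  rw [condEntropy_eq_sum_neg_log]
  refine Finset.sum_nonneg fun w _ =>
    mul_nonneg (p.nonneg _ _) (neg_nonneg.2 (Real.log_nonpos ?_ ?_))
  · exact div_nonneg (p.nonneg _ _) (p.nonneg _ _)
  · exact div_le_one_of_le₀ (p.prob_le_prob_init w) (p.nonneg _ _)

theorem isTransitionKernel_tail (n : ℕ) : p.IsTransitionKernel fun w : Fin (n + 2) → A =>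
    p.prob (n + 1) (Fin.tail w) / p.prob n (Fin.init (Fin.tail w)) where
  nonneg w := div_nonneg (p.nonneg _ _) (p.nonneg _ _)
  sum_le_one w := by
    rw [← Fin.cons_self_tail w]
    simp only [← Fin.cons_snoc_eq_snoc_cons, Fin.tail_cons, Fin.init_snoc]
    rw [← Finset.sum_div, p.sum_snoc]
    exact div_self_le_one _
  ne_zero w hw :=
    div_ne_zero (prob_tail_ne_zero hw) (prob_init_ne_zero (prob_tail_ne_zero hw))

theorem condEntropy_antitone : Antitone p.condEntropy :=
  antitone_nat_of_succ_le fun n => (p.isTransitionKernel_tail n).condEntropy_le.trans_eq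
    ((p.sum_prob_mul_tail _).trans (p.condEntropy_eq_sum_neg_log n).symm)

theorem blockEntropy_eq_sum (n : ℕ) :
    p.blockEntropy n = ∑ k ∈ Finset.range n, p.condEntropy k := by
  simp only [condEntropy, Finset.sum_range_sub]
  simp [blockEntropy, p.prob_zero]

/-- The entropy rate of the process. -/
noncomputable def entropyRate : ℝ := ⨅ n, p.condEntropy n

theorem bddBelow_range_condEntropy : BddBelow (Set.range p.condEntropy) :=
  ⟨0, Set.forall_mem_range.2 p.condEntropy_nonneg⟩

theorem entropyRate_le (n : ℕ) : p.entropyRate ≤ p.condEntropy n :=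
  ciInf_le p.bddBelow_range_condEntropy n

theorem tendsto_blockEntropy_div :
    Tendsto (fun n : ℕ => p.blockEntropy n / n) atTop (nhds p.entropyRate) := by
  refine (tendsto_atTop_ciInf p.condEntropy_antitone p.bddBelow_range_condEntropy).cesaro.congr
    fun n => ?_
  rw [p.blockEntropy_eq_sum, div_eq_inv_mul]

/-- The law of a letter. -/
def letter (a : A) : ℝ := p.prob 1 ![a]

/-- The law of two consecutive letters. -/
def pair (a b : A) : ℝ := p.prob 2 ![a, b]

theorem letter_nonneg (a : A) : 0 ≤ p.letter a := p.nonneg _ _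

theorem pair_nonneg (a b : A) : 0 ≤ p.pair a b := p.nonneg _ _

theorem sum_pair_right (a : A) : ∑ b, p.pair a b = p.letter a := by
  rw [letter, ← p.sum_snoc]
  refine Finset.sum_congr rfl fun b _ => congrArg (p.prob 2) ?_
  ext i
  fin_cases i <;> rfl

theorem sum_pair_left (b : A) : ∑ a, p.pair a b = p.letter b := p.sum_cons 1 ![b]

theorem sum_letter : ∑ a, p.letter a = 1 :=
  (p.sum_cons 0 ![]).trans (p.prob_zero _)

theorem sum_prob_mul_last_two (n : ℕ) (f : A → A → ℝ) :
    ∑ w : Fin (n + 2) → A,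
        p.prob (n + 2) w * f (w (Fin.last n).castSucc) (w (Fin.last (n + 1))) =
      ∑ a, ∑ b, p.pair a b * f a b := by
  induction n with
  | zero =>
    rw [← (finTwoArrowEquiv A).symm.sum_comp, Fintype.sum_prod_type]
    rfl
  | succ n ih =>
    rw [← ih]
    exact p.sum_prob_mul_tail fun w => f (w (Fin.last n).castSucc) (w (Fin.last (n + 1)))

theorem prob_le_pair (w : Fin (n + 2) → A) :
    p.prob (n + 2) w ≤ p.pair (w (Fin.last n).castSucc) (w (Fin.last (n + 1))) := by
  induction n with
  | zero =>
    refine (congrArg (p.prob 2) ?_).le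
    ext i
    fin_cases i <;> rfl
  | succ n ih => exact (p.prob_le_prob_tail w).trans (ih (Fin.tail w))

/-- The mean of `f` is the same before and after a transition, so it cannot increase along one. -/
theorem eq_of_le_along_pairs {f : A → ℝ} (hf : ∀ a b, 0 < p.pair a b → f a ≤ f b) {a b : A}
    (hab : 0 < p.pair a b) : f a = f b := by
  have hterm (a b : A) : 0 ≤ p.pair a b * (f b - f a) := by
    rcases (p.pair_nonneg a b).eq_or_lt with h | h
    · rw [← h, zero_mul]
    · exact mul_nonneg h.le (sub_nonneg.2 (hf a b h))
  have hmean : ∑ a, ∑ b, p.pair a b * (f b - f a) = 0 := by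
    simp only [mul_sub, Finset.sum_sub_distrib, ← Finset.sum_mul, p.sum_pair_right]
    rw [Finset.sum_comm]
    simp only [← Finset.sum_mul, p.sum_pair_left, sub_self]
  have hrow := (Finset.sum_eq_zero_iff_of_nonneg fun a _ =>
    Finset.sum_nonneg fun b _ => hterm a b).1 hmean a (Finset.mem_univ a)
  have hzero := (Finset.sum_eq_zero_iff_of_nonneg fun b _ => hterm a b).1 hrow b (Finset.mem_univ b)
  exact (sub_eq_zero.1 ((mul_eq_zero.1 hzero).resolve_left hab.ne')).symm

theorem recurrentEdge_of_pair_pos {E : A → A → Prop} (hE : ∀ a b, 0 < p.pair a b → E a b)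
    {a b : A} (hab : 0 < p.pair a b) : RecurrentEdge E a b := by
  refine ⟨hE a b hab, ?_⟩
  let S : Set A := {c | ReflTransGen E b c}
  have hS : S.indicator (1 : A → ℝ) a = S.indicator 1 b := by
    refine p.eq_of_le_along_pairs (fun c d hcd => ?_) hab
    by_cases hc : c ∈ S
    · have hd : d ∈ S := ReflTransGen.tail hc (hE c d hcd)
      simp [hc, hd]
    · rw [Set.indicator_of_notMem hc]
      exact Set.indicator_nonneg (fun _ _ => zero_le_one) d
  have hb : b ∈ S := ReflTransGen.refl
  rw [Set.indicator_of_mem hb, Pi.one_apply] at hS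
  exact Set.mem_of_indicator_ne_zero (hS ▸ one_ne_zero)

theorem exists_pair_pos_of_letter_pos {a : A} (ha : 0 < p.letter a) : ∃ b, 0 < p.pair a b := by
  rw [← p.sum_pair_right] at ha
  obtain ⟨b, -, hb⟩ := Finset.exists_lt_of_sum_lt (f := fun _ => (0 : ℝ)) (by simpa using ha)
  exact ⟨b, hb⟩

end StationaryLaw

section AdjacencyMatrix

variable {ι : Type*} {G : ι → ι → Prop}

/-- The adjacency matrix of a directed graph. -/
noncomputable def adjacencyMatrix (G : ι → ι → Prop) : Matrix ι ι ℝ :=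
  open scoped Classical in .of fun a b => if G a b then 1 else 0

theorem adjacencyMatrix_nonneg (a b : ι) : 0 ≤ adjacencyMatrix G a b := by
  simp only [adjacencyMatrix, Matrix.of_apply]
  split_ifs <;> norm_num

theorem adjacencyMatrix_of_edge {a b : ι} (hab : G a b) : adjacencyMatrix G a b = 1 := by
  simp [adjacencyMatrix, hab]

theorem adjacencyMatrix_pos_iff {a b : ι} : 0 < adjacencyMatrix G a b ↔ G a b := by
  by_cases hab : G a b <;> simp [adjacencyMatrix, hab]

end AdjacencyMatrix

section Parry

variable {ι : Type*} [Fintype ι] {M : Matrix ι ι ℝ} {lam r : ι → ℝ}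

/-- The transition matrix of the Parry measure, the Markov chain obtained from a nonnegative
matrix by the change of variables along its Perron eigenvectors. -/
noncomputable def parryMatrix (M : Matrix ι ι ℝ) (lam r : ι → ℝ) : Matrix ι ι ℝ :=
  .of fun a b => M a b * r b / (lam a * r a)

namespace IsPerronPair

theorem sum_mul_eq (h : IsPerronPair M lam r) (a : ι) : ∑ b, M a b * r b = lam a * r a :=
  congrFun h.mulVec_eq a

theorem eigenvalue_pos (h : IsPerronPair M lam r) (hM : ∀ a b, 0 ≤ M a b) {a b : ι}
    (hab : 0 < M a b) : 0 < lam a := by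
  refine pos_of_mul_pos_left ?_ (h.pos a).le
  rw [← h.sum_mul_eq]
  exact Finset.sum_pos' (fun c _ => mul_nonneg (hM a c) (h.pos c).le)
    ⟨b, Finset.mem_univ b, mul_pos hab (h.pos b)⟩

theorem parryMatrix_pos (h : IsPerronPair M lam r) (hM : ∀ a b, 0 ≤ M a b) {a b : ι}
    (hab : 0 < M a b) : 0 < parryMatrix M lam r a b :=
  div_pos (mul_pos hab (h.pos b)) (mul_pos (h.eigenvalue_pos hM hab) (h.pos a))

theorem parryMatrix_nonneg (h : IsPerronPair M lam r) (hM : ∀ a b, 0 ≤ M a b) (a b : ι) :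
    0 ≤ parryMatrix M lam r a b := by
  rcases (hM a b).eq_or_lt with hab | hab
  · simp [parryMatrix, ← hab]
  · exact (h.parryMatrix_pos hM hab).le

theorem sum_parryMatrix_le_one (h : IsPerronPair M lam r) (a : ι) :
    ∑ b, parryMatrix M lam r a b ≤ 1 := by
  simp only [parryMatrix, Matrix.of_apply]
  rw [← Finset.sum_div, h.sum_mul_eq]
  exact div_self_le_one _

end IsPerronPair

variable {G : ι → ι → Prop}

theorem exists_isPerronPair_adjacencyMatrix (hG : ∀ a b, G a b → ReflTransGen G b a) :
    ∃ lam r : ι → ℝ, IsPerronPair (adjacencyMatrix G) lam r :=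
  exists_isPerronPair adjacencyMatrix_nonneg fun a b hab => by
    simpa only [adjacencyMatrix_pos_iff] using hG a b (adjacencyMatrix_pos_iff.1 hab)

theorem IsPerronPair.log_parryMatrix_of_edge (h : IsPerronPair (adjacencyMatrix G) lam r)
    {a b : ι} (hab : G a b) :
    Real.log (parryMatrix (adjacencyMatrix G) lam r a b) =
      Real.log (r b) - Real.log (r a) - Real.log (lam a) := by
  have hlam := h.eigenvalue_pos adjacencyMatrix_nonneg (adjacencyMatrix_pos_iff.2 hab)
  rw [parryMatrix, Matrix.of_apply, adjacencyMatrix_of_edge hab, one_mul,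
    Real.log_div (h.pos b).ne' (mul_pos hlam (h.pos a)).ne',
    Real.log_mul hlam.ne' (h.pos a).ne']
  ring

end Parry

namespace StationaryLaw

variable {A : Type*} [Fintype A] {p q : StationaryLaw A} {G : A → A → Prop} {lam r : A → ℝ}

theorem isTransitionKernel_parryMatrix (h : IsPerronPair (adjacencyMatrix G) lam r)
    (hG : ∀ a b, 0 < p.pair a b → G a b) (n : ℕ) :
    p.IsTransitionKernel fun w : Fin (n + 2) → A =>
      parryMatrix (adjacencyMatrix G) lam r (w (Fin.last n).castSucc) (w (Fin.last (n + 1))) where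
  nonneg w := h.parryMatrix_nonneg adjacencyMatrix_nonneg _ _
  sum_le_one w := by
    simp only [Fin.snoc_castSucc, Fin.snoc_last]
    exact h.sum_parryMatrix_le_one _
  ne_zero w hw := by
    have hpair := ((p.nonneg _ w).lt_of_ne' hw).trans_le (p.prob_le_pair w)
    exact (h.parryMatrix_pos adjacencyMatrix_nonneg
      (adjacencyMatrix_pos_iff.2 (hG _ _ hpair))).ne'

theorem sum_pair_mul_neg_log_parryMatrix (h : IsPerronPair (adjacencyMatrix G) lam r)
    (hG : ∀ a b, 0 < p.pair a b → G a b) :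
    ∑ a, ∑ b, p.pair a b * -Real.log (parryMatrix (adjacencyMatrix G) lam r a b) =
      ∑ a, p.letter a * Real.log (lam a) := by
  have hpair (a b : A) :
      p.pair a b * -Real.log (parryMatrix (adjacencyMatrix G) lam r a b) =
        p.pair a b * (Real.log (lam a) + Real.log (r a)) - p.pair a b * Real.log (r b) := by
    rcases (p.pair_nonneg a b).eq_or_lt with h0 | h0
    · simp [← h0]
    · rw [h.log_parryMatrix_of_edge (hG a b h0)]
      ring
  have hright : ∑ a, ∑ b, p.pair a b * Real.log (r b) = ∑ b, p.letter b * Real.log (r b) := by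
    rw [Finset.sum_comm]
    simp only [← Finset.sum_mul, p.sum_pair_left]
  simp only [hpair, Finset.sum_sub_distrib, hright, ← Finset.sum_mul, p.sum_pair_right, mul_add,
    Finset.sum_add_distrib, add_sub_cancel_right]

theorem sum_prob_mul_neg_log_parryMatrix (h : IsPerronPair (adjacencyMatrix G) lam r)
    (hG : ∀ a b, 0 < p.pair a b → G a b) (n : ℕ) :
    ∑ w : Fin (n + 2) → A, p.prob (n + 2) w * -Real.log (parryMatrix (adjacencyMatrix G) lam r
        (w (Fin.last n).castSucc) (w (Fin.last (n + 1)))) =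
      ∑ a, p.letter a * Real.log (lam a) :=
  (p.sum_prob_mul_last_two n _).trans (sum_pair_mul_neg_log_parryMatrix h hG)

theorem entropyRate_le_sum_letter_mul_log (h : IsPerronPair (adjacencyMatrix G) lam r)
    (hG : ∀ a b, 0 < p.pair a b → G a b) :
    p.entropyRate ≤ ∑ a, p.letter a * Real.log (lam a) :=
  (p.entropyRate_le 1).trans <| (isTransitionKernel_parryMatrix h hG 0).condEntropy_le.trans_eq
    (sum_prob_mul_neg_log_parryMatrix h hG 0)

/-- The process has at least the entropy of every component of the graph `G`. -/
def DominatesEigenvalues (p : StationaryLaw A) (G : A → A → Prop) (lam : A → ℝ) : Prop :=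
  ∀ a b, G a b → Real.log (lam a) ≤ p.entropyRate

theorem letter_mul_log_le (hG : ∀ a b, 0 < p.pair a b → G a b)
    (hmax : p.DominatesEigenvalues G lam) (a : A) :
    p.letter a * Real.log (lam a) ≤ p.letter a * p.entropyRate := by
  rcases (p.letter_nonneg a).eq_or_lt with h0 | h0
  · simp [← h0]
  · obtain ⟨b, hab⟩ := p.exists_pair_pos_of_letter_pos h0
    exact mul_le_mul_of_nonneg_left (hmax a b (hG a b hab)) h0.le

theorem sum_letter_mul_log_le (hG : ∀ a b, 0 < p.pair a b → G a b)
    (hmax : p.DominatesEigenvalues G lam) :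
    ∑ a, p.letter a * Real.log (lam a) ≤ p.entropyRate := by
  refine (Finset.sum_le_sum fun a _ => letter_mul_log_le hG hmax a).trans_eq ?_
  rw [← Finset.sum_mul, p.sum_letter, one_mul]

theorem log_eigenvalue_eq_entropyRate (h : IsPerronPair (adjacencyMatrix G) lam r)
    (hG : ∀ a b, 0 < p.pair a b → G a b) (hmax : p.DominatesEigenvalues G lam) {a : A}
    (ha : 0 < p.letter a) : Real.log (lam a) = p.entropyRate := by
  have hsum : ∑ a, p.letter a * Real.log (lam a) = ∑ a, p.letter a * p.entropyRate := by
    rw [← Finset.sum_mul, p.sum_letter, one_mul]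
    exact (sum_letter_mul_log_le hG hmax).antisymm (entropyRate_le_sum_letter_mul_log h hG)
  exact mul_left_cancel₀ ha.ne' ((Finset.sum_eq_sum_iff_of_le fun a _ =>
    letter_mul_log_le hG hmax a).1 hsum a (Finset.mem_univ a))

/-- The equality case of `entropyRate_le_sum_letter_mul_log`. -/
theorem prob_eq_prob_init_mul_parryMatrix (h : IsPerronPair (adjacencyMatrix G) lam r)
    (hG : ∀ a b, 0 < p.pair a b → G a b) (hmax : p.DominatesEigenvalues G lam) {n : ℕ}
    (w : Fin (n + 2) → A) :
    p.prob (n + 2) w = p.prob (n + 1) (Fin.init w) *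
      parryMatrix (adjacencyMatrix G) lam r (w (Fin.last n).castSucc) (w (Fin.last (n + 1))) :=
  (isTransitionKernel_parryMatrix h hG n).prob_eq_of_le_condEntropy
    ((sum_prob_mul_neg_log_parryMatrix h hG n).trans_le
      ((sum_letter_mul_log_le hG hmax).trans (p.entropyRate_le (n + 1)))) w

theorem parryMatrix_transpose_mulVec_letter (h : IsPerronPair (adjacencyMatrix G) lam r)
    (hG : ∀ a b, 0 < p.pair a b → G a b) (hmax : p.DominatesEigenvalues G lam) :
    (parryMatrix (adjacencyMatrix G) lam r)ᵀ *ᵥ p.letter = (1 : ℝ) • p.letter := by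
  ext b
  rw [one_smul, ← p.sum_pair_left]
  refine Finset.sum_congr rfl fun a _ => ?_
  have hpair : p.pair a b = p.letter a * parryMatrix (adjacencyMatrix G) lam r a b := by
    refine (prob_eq_prob_init_mul_parryMatrix h hG hmax ![a, b]).trans ?_
    congr 2
    exact funext fun i => by fin_cases i; rfl
  rw [hpair]
  exact mul_comm _ _

theorem letter_mem_stdSimplex (p : StationaryLaw A) : p.letter ∈ stdSimplex ℝ A :=
  ⟨p.letter_nonneg, p.sum_letter⟩

theorem prob_eq_of_unique_maximal_class (h : IsPerronPair (adjacencyMatrix G) lam r)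
    (hGsymm : ∀ a b, G a b → ReflTransGen G b a)
    (hp : ∀ a b, 0 < p.pair a b → G a b) (hq : ∀ a b, 0 < q.pair a b → G a b)
    (hpq : p.entropyRate = q.entropyRate) (hmax : p.DominatesEigenvalues G lam) {c : A}
    (hc : ∀ a b, G a b → Real.log (lam a) = p.entropyRate → ReflTransGen G c a)
    (n : ℕ) (w : Fin n → A) : p.prob n w = q.prob n w := by
  have hmaxq : q.DominatesEigenvalues G lam := fun a b hab => hpq ▸ hmax a b hab
  have hzero (s : StationaryLaw A) (hs : ∀ a b, 0 < s.pair a b → G a b)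
      (hsp : s.entropyRate = p.entropyRate) (a : A) (ha : a ∉ {a | ReflTransGen G c a}) :
      s.letter a = 0 := by
    refine not_not.1 fun hne => ha ?_
    have hpos := (s.letter_nonneg a).lt_of_ne' hne
    obtain ⟨b, hab⟩ := s.exists_pair_pos_of_letter_pos hpos
    refine hc a b (hs a b hab) ?_
    exact (log_eigenvalue_eq_entropyRate h hs (fun a b hab => hsp ▸ hmax a b hab) hpos).trans hsp
  have hletter : p.letter = q.letter := by
    refine eq_of_mulVec_eq_smul_of_mem_stdSimplex (S := {a | ReflTransGen G c a})
      (fun a b => h.parryMatrix_nonneg adjacencyMatrix_nonneg b a) (fun a ha b hb => ?_)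
      p.letter_mem_stdSimplex q.letter_mem_stdSimplex (hzero p hp rfl) (hzero q hq hpq.symm)
      (parryMatrix_transpose_mulVec_letter h hp hmax)
      (parryMatrix_transpose_mulVec_letter h hq hmaxq)
    have hba : ReflTransGen G b a := ((reachabilitySetoid hGsymm).symm hb).trans ha
    refine reflTransGen_swap.1 (ReflTransGen.mono (fun i j hij => ?_) _ _ hba)
    exact h.parryMatrix_pos adjacencyMatrix_nonneg (adjacencyMatrix_pos_iff.2 hij)
  match n with
  | 0 => rw [p.prob_zero, q.prob_zero]
  | n + 1 =>
    induction n with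
    | zero =>
      rw [show w = ![w 0] from funext fun i => by fin_cases i; rfl]
      exact congrFun hletter (w 0)
    | succ n ih =>
      rw [prob_eq_prob_init_mul_parryMatrix h hp hmax, ih,
        prob_eq_prob_init_mul_parryMatrix h hq hmaxq]

end StationaryLaw

section BiInfinitePaths

variable {α : Type*} {R : α → α → Prop}

theorem exists_nat_path_extending (hsucc : ∀ a, ∃ b, R a b) {n : ℕ} (w : Fin (n + 1) → α)
    (hw : ∀ i : Fin n, R (w i.castSucc) (w i.succ)) :
    ∃ u : ℕ → α, (∀ k, R (u k) (u (k + 1))) ∧ ∀ i : Fin (n + 1), u i = w i := by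
  induction n with
  | zero =>
    choose f hf using hsucc
    refine ⟨fun k => f^[k] (w 0), fun k => ?_, Fin.forall_fin_one.2 rfl⟩
    simp only [Function.iterate_succ_apply']
    exact hf _
  | succ n ih =>
    obtain ⟨u, hu, huw⟩ := ih (Fin.tail w) fun i => hw i.succ
    refine ⟨fun | 0 => w 0 | k + 1 => u k, ?_, Fin.cases rfl huw⟩
    rintro (_ | k)
    · exact (congrArg (R (w 0)) (huw 0)).mpr (hw 0)
    · exact hu k

theorem exists_int_path_extending (hpred : ∀ b, ∃ a, R a b) (u : ℕ → α)
    (hu : ∀ k, R (u k) (u (k + 1))) :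
    ∃ z : ℤ → α, (∀ v, R (z v) (z (v + 1))) ∧ ∀ k : ℕ, z k = u k := by
  choose g hg using hpred
  refine ⟨fun | .ofNat k => u k | .negSucc k => g^[k + 1] (u 0), ?_, fun _ => rfl⟩
  rintro (k | _ | k)
  · exact hu k
  · exact hg (u 0)
  · rw [show Int.negSucc (k + 1) + 1 = Int.negSucc k from rfl]
    simp only [Function.iterate_succ_apply' g (k + 1)]
    exact hg _

end BiInfinitePaths

section GraphPaths

variable {A : Type*} [Fintype A] {G : A → A → Prop} {S : Set A} {n : ℕ}

/-- The vertex sequences of the paths with `n` edges of the graph `G` that start in `S`. -/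
noncomputable def graphPaths (G : A → A → Prop) (S : Set A) (n : ℕ) : Finset (Fin (n + 1) → A) :=
  open scoped Classical in {w | w 0 ∈ S ∧ ∀ i : Fin n, G (w i.castSucc) (w i.succ)}

theorem mem_graphPaths {w : Fin (n + 1) → A} :
    w ∈ graphPaths G S n ↔ w 0 ∈ S ∧ ∀ i : Fin n, G (w i.castSucc) (w i.succ) := by
  classical
  simp [graphPaths]

theorem snoc_mem_graphPaths {w : Fin (n + 1) → A} {b : A} :
    (Fin.snoc w b : Fin (n + 2) → A) ∈ graphPaths G S (n + 1) ↔
      w ∈ graphPaths G S n ∧ G (w (Fin.last n)) b := by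
  rw [mem_graphPaths, mem_graphPaths, Fin.forall_fin_succ', and_assoc, ← Fin.castSucc_zero,
    Fin.snoc_castSucc]
  simp only [Fin.succ_castSucc, Fin.snoc_castSucc, Fin.succ_last, Fin.snoc_last]

theorem sum_graphPaths_succ (f : A → ℝ) :
    ∑ w ∈ graphPaths G S (n + 1), f (w (Fin.last (n + 1))) =
      ∑ w ∈ graphPaths G S n, ∑ b, adjacencyMatrix G (w (Fin.last n)) b * f b := by
  classical
  rw [← Finset.univ_inter (graphPaths G S (n + 1)), ← Finset.sum_ite_mem, sum_eq_sum_snoc,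
    ← Finset.univ_inter (graphPaths G S n), ← Finset.sum_ite_mem]
  refine Finset.sum_congr rfl fun w _ => ?_
  by_cases hw : w ∈ graphPaths G S n
  · simp [snoc_mem_graphPaths, hw, adjacencyMatrix]
  · simp [snoc_mem_graphPaths, hw]

namespace IsPerronPair

variable {lam r : A → ℝ} {L : ℝ}

theorem eigenvalue_last_eq (h : IsPerronPair (adjacencyMatrix G) lam r) (hS : ∀ a ∈ S, lam a = L)
    {w : Fin (n + 1) → A} (hw : w ∈ graphPaths G S n) : lam (w (Fin.last n)) = L := by
  rw [mem_graphPaths] at hw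
  have hconst (i : Fin (n + 1)) : lam (w i) = L := by
    induction i using Fin.induction with
    | zero => exact hS _ hw.1
    | succ i ih => rw [← h.lam_eq _ _ (adjacencyMatrix_pos_iff.2 (hw.2 i)), ih]
  exact hconst _

theorem sum_graphPaths_eq (h : IsPerronPair (adjacencyMatrix G) lam r)
    (hS : ∀ a ∈ S, lam a = L) (n : ℕ) :
    ∑ w ∈ graphPaths G S n, r (w (Fin.last n)) = (∑ w ∈ graphPaths G S 0, r (w 0)) * L ^ n := by
  induction n with
  | zero => simp
  | succ n ih =>
    rw [sum_graphPaths_succ, pow_succ, ← mul_assoc, ← ih, Finset.sum_mul]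
    refine Finset.sum_congr rfl fun w hw => ?_
    rw [h.sum_mul_eq, h.eigenvalue_last_eq hS hw, mul_comm]

theorem exists_card_graphPaths_bounds (h : IsPerronPair (adjacencyMatrix G) lam r)
    (hS : ∀ a ∈ S, lam a = L) (hSne : S.Nonempty) :
    ∃ c C : ℝ, 0 < c ∧ ∀ n, c * L ^ n ≤ (graphPaths G S n).card ∧
      (graphPaths G S n).card ≤ C * L ^ n := by
  obtain ⟨s, hs⟩ := hSne
  have : Nonempty A := ⟨s⟩
  obtain ⟨a, ha⟩ := Finite.exists_max r
  obtain ⟨b, hb⟩ := Finite.exists_min r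
  have hW : 0 < ∑ w ∈ graphPaths G S 0, r (w 0) :=
    Finset.sum_pos (fun w _ => h.pos _) ⟨fun _ => s, mem_graphPaths.2 ⟨hs, fun i => i.elim0⟩⟩
  refine ⟨(∑ w ∈ graphPaths G S 0, r (w 0)) / r a, (∑ w ∈ graphPaths G S 0, r (w 0)) / r b,
    div_pos hW (h.pos a), fun n => ⟨?_, ?_⟩⟩
  · rw [div_mul_eq_mul_div, div_le_iff₀ (h.pos a), ← h.sum_graphPaths_eq hS, ← nsmul_eq_mul]
    exact Finset.sum_le_card_nsmul _ _ _ fun w _ => ha _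
  · rw [div_mul_eq_mul_div, le_div_iff₀ (h.pos b), ← h.sum_graphPaths_eq hS, ← nsmul_eq_mul]
    exact Finset.card_nsmul_le_sum _ _ _ fun w _ => hb _

end IsPerronPair

end GraphPaths

theorem tendsto_log_div_natCast {N : ℕ → ℝ} {c C L : ℝ} (hc : 0 < c) (hL : 0 < L)
    (hlow : ∀ᶠ n in atTop, c * L ^ n ≤ N n) (hup : ∀ᶠ n in atTop, N n ≤ C * L ^ n) :
    Tendsto (fun n : ℕ => Real.log (N n) / n) atTop (nhds (Real.log L)) := by
  have hlim (B : ℝ) :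
      Tendsto (fun n : ℕ => Real.log B / n + Real.log L) atTop (nhds (Real.log L)) := by
    simpa only [zero_add] using
      (tendsto_const_div_atTop_nhds_zero_nat (Real.log B)).add_const (Real.log L)
  have hlog {B : ℝ} (hB : B ≠ 0) {n : ℕ} (hn : 0 < n) :
      Real.log (B * L ^ n) / n = Real.log B / n + Real.log L := by
    rw [Real.log_mul hB (pow_pos hL n).ne', Real.log_pow]
    field_simp
  refine tendsto_of_tendsto_of_tendsto_of_le_of_le' (hlim c) (hlim C) ?_ ?_
  · filter_upwards [hlow, eventually_gt_atTop 0] with n hlow hn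
    rw [← hlog hc.ne' hn]
    gcongr
  · filter_upwards [hlow, hup, eventually_gt_atTop 0] with n hlow hup hn
    have hN : 0 < N n := (mul_pos hc (pow_pos hL n)).trans_le hlow
    rw [← hlog (pos_of_mul_pos_left (hN.trans_le hup) (pow_pos hL n).le).ne' hn]
    gcongr

section TopologicalEntropy

variable {A : Type} {X Y : Set (FullShift 1 A)}

/-- The block of length `n` of a point, read at the sites `1, …, n`. -/
def block (n : ℕ) (x : FullShift 1 A) : Fin n → A :=
  fun i => x fun _ => (i : ℤ) + 1

/-- The enumeration of the sites `1, …, n` of a one-dimensional box. -/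
def boxEquiv (n : Fin 1 → ℕ) : Fin (n 0) ≃ box n where
  toFun i := ⟨fun _ => (i : ℤ) + 1, by
    rw [box, Fintype.mem_piFinset, Fin.forall_fin_one, Finset.mem_Icc]
    omega⟩
  invFun s := ⟨(s.1 0 - 1).toNat, by
    have := Finset.mem_Icc.1 (Fintype.mem_piFinset.1 s.2 0)
    omega⟩
  left_inv i := by ext; simp
  right_inv s := by
    have := Finset.mem_Icc.1 (Fintype.mem_piFinset.1 s.2 0)
    ext j
    rw [Subsingleton.elim j 0]
    simp only
    omega

theorem ncard_languageOn_box (X : Set (FullShift 1 A)) (n : Fin 1 → ℕ) :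
    (languageOn X (box n)).ncard = (block (n 0) '' X).ncard := by
  rw [← Set.ncard_image_of_injective (languageOn X (box n))
    ((boxEquiv n).arrowCongr (Equiv.refl A)).symm.injective]
  congr 1
  ext w
  constructor
  · rintro ⟨u, ⟨x, hx, hxu⟩, rfl⟩
    exact ⟨x, hx, funext fun i => hxu (boxEquiv n i)⟩
  · rintro ⟨x, hx, rfl⟩
    exact ⟨fun s => x s, ⟨x, hx, fun _ => rfl⟩, rfl⟩

theorem const_add_single_one (k : ℤ) :
    (fun _ : Fin 1 => k) + Pi.single 0 1 = fun _ => k + 1 :=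
  funext fun j => by simp [Subsingleton.elim j 0]

theorem tendsto_apply_atTop {ι : Type*} (i : ι) :
    Tendsto (fun n : ι → ℕ => n i) atTop atTop :=
  tendsto_atTop_atTop.2 fun b => ⟨fun _ => b, fun _ h => h i⟩

theorem topologicalEntropy_eq_of_tendsto {h : ℝ}
    (hX : Tendsto (fun n : ℕ => Real.log (block n '' X).ncard / n) atTop (nhds h)) :
    topologicalEntropy X = h := by
  refine Tendsto.limUnder_eq ((hX.comp (tendsto_apply_atTop 0)).congr fun n => ?_)
  simp only [Function.comp_apply, ncard_languageOn_box, Fin.prod_univ_one]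

section Finite

variable [Finite A]

theorem ncard_image_block_pos (hX : X.Nonempty) (n : ℕ) : 0 < (block n '' X).ncard :=
  (Set.ncard_pos (Set.toFinite _)).2 (hX.image _)

theorem ncard_image_block_add_le (hX : ∀ t, Set.MapsTo (FullShift.shift t) X X) (m n : ℕ) :
    (block (m + n) '' X).ncard ≤ (block m '' X).ncard * (block n '' X).ncard := by
  rw [← Set.ncard_prod]
  refine Set.ncard_le_ncard_of_injOn (Fin.appendEquiv m n).symm ?_
    (Fin.appendEquiv m n).symm.injective.injOn (Set.toFinite _)
  rintro _ ⟨x, hx, rfl⟩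
  refine ⟨⟨x, hx, rfl⟩, ⟨_, hX (fun _ => (m : ℤ)) hx, funext fun i => congrArg x ?_⟩⟩
  funext _
  simp only [Pi.add_apply, Fin.val_natAdd]
  push_cast
  ring

theorem tendsto_topologicalEntropy (hX : X.Nonempty)
    (hshift : ∀ t, Set.MapsTo (FullShift.shift t) X X) :
    Tendsto (fun n : ℕ => Real.log (block n '' X).ncard / n) atTop
      (nhds (topologicalEntropy X)) := by
  have hpos (n : ℕ) : (0 : ℝ) < (block n '' X).ncard := Nat.cast_pos.2 (ncard_image_block_pos hX n)
  have hsub : Subadditive fun n : ℕ => Real.log (block n '' X).ncard := fun m n => by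
    rw [← Real.log_mul (hpos m).ne' (hpos n).ne']
    exact Real.log_le_log (hpos _) (by exact_mod_cast ncard_image_block_add_le hshift m n)
  have hlim := hsub.tendsto_lim ⟨0, Set.forall_mem_range.2 fun n =>
    div_nonneg (Real.log_natCast_nonneg _) n.cast_nonneg⟩
  rwa [topologicalEntropy_eq_of_tendsto hlim]

theorem topologicalEntropy_mono (hX : X.Nonempty)
    (hXshift : ∀ t, Set.MapsTo (FullShift.shift t) X X)
    (hYshift : ∀ t, Set.MapsTo (FullShift.shift t) Y Y) (hXY : X ⊆ Y) :
    topologicalEntropy X ≤ topologicalEntropy Y := by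
  refine le_of_tendsto_of_tendsto' (tendsto_topologicalEntropy hX hXshift)
    (tendsto_topologicalEntropy (hX.mono hXY) hYshift) fun n => ?_
  have hpos : (0 : ℝ) < (block n '' X).ncard := Nat.cast_pos.2 (ncard_image_block_pos hX n)
  have hle := Set.ncard_le_ncard (Set.image_mono (f := block n) hXY) (Set.toFinite _)
  gcongr

end Finite

/-- The configurations all of whose letters lie in `S`, that is `S^(ℤ^d)` as a subshift. -/
def fullSubshift (d : ℕ) {A : Type} (S : Set A) : Set (FullShift d A) :=
  {x | ∀ v, x v ∈ S}

theorem ncard_image_block_fullSubshift {S : Set A} (hS : S.Nonempty) (n : ℕ) :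
    (block n '' fullSubshift 1 S).ncard = S.ncard ^ n := by
  have himage : block n '' fullSubshift 1 S = Set.univ.pi fun _ => S := by
    ext w
    constructor
    · rintro ⟨x, hx, rfl⟩ i -
      exact hx _
    · intro hw
      obtain ⟨a, ha⟩ := hS
      refine ⟨fun s => if h : (s 0 - 1).toNat < n then w ⟨_, h⟩ else a, fun v => ?_,
        funext fun i => by simp [block]⟩
      simp only
      split_ifs with h
      exacts [hw _ (Set.mem_univ _), ha]
  rw [himage, ← Nat.card_coe_set_eq, Nat.card_congr (Equiv.Set.univPi fun _ => S), Nat.card_pi,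
    Finset.prod_const, Finset.card_univ, Fintype.card_fin, Nat.card_coe_set_eq]

theorem mapsTo_shift_fullSubshift {d : ℕ} {S : Set A} (t : Fin d → ℤ) :
    Set.MapsTo (FullShift.shift t) (fullSubshift d S) (fullSubshift d S) :=
  fun _ hx v => hx (v + t)

variable [Finite A] {S : Set A}

theorem topologicalEntropy_fullSubshift (hS : S.Nonempty) :
    topologicalEntropy (fullSubshift 1 S) = Real.log S.ncard := by
  have hpos : (0 : ℝ) < S.ncard := Nat.cast_pos.2 ((Set.ncard_pos (Set.toFinite _)).2 hS)
  have hcard (n : ℕ) : ((block n '' fullSubshift 1 S).ncard : ℝ) = 1 * (S.ncard : ℝ) ^ n := by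
    rw [ncard_image_block_fullSubshift hS, Nat.cast_pow, one_mul]
  exact topologicalEntropy_eq_of_tendsto (tendsto_log_div_natCast one_pos hpos
    (.of_forall fun n => (hcard n).ge) (.of_forall fun n => (hcard n).le))

theorem topologicalEntropy_le_log_ncard (hX : X.Nonempty)
    (hshift : ∀ t, Set.MapsTo (FullShift.shift t) X X) (hXS : X ⊆ fullSubshift 1 S) :
    topologicalEntropy X ≤ Real.log S.ncard := by
  obtain ⟨x, hx⟩ := hX
  rw [← topologicalEntropy_fullSubshift ⟨x 0, hXS hx 0⟩]
  exact topologicalEntropy_mono ⟨x, hx⟩ hshift mapsTo_shift_fullSubshift hXS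

end TopologicalEntropy

namespace FullShift

variable {d : ℕ} {A : Type}

theorem measurable_eval (s : Fin d → ℤ) : @Measurable (FullShift d A) A _ ⊤ fun x => x s :=
  @measurable_pi_apply (Fin d → ℤ) (fun _ => A) (fun _ => ⊤) s

theorem measurable_shift (t : Fin d → ℤ) : Measurable (shift t : FullShift d A → FullShift d A) :=
  @measurable_pi_lambda _ _ _ _ (fun _ => ⊤) _ fun s => measurable_eval (s + t)

theorem measurableSet_eval_eq (s : Fin d → ℤ) (a : A) :
    MeasurableSet {x : FullShift d A | x s = a} :=
  let _ : MeasurableSpace A := ⊤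
  measurable_eval s (MeasurableSpace.measurableSet_top (s := {a}))

theorem sum_measureReal_inter_eval [Fintype A] {μ : Measure (FullShift d A)} [IsFiniteMeasure μ]
    {C : Set (FullShift d A)} (hC : MeasurableSet C) (s : Fin d → ℤ) :
    ∑ a, μ.real (C ∩ {x | x s = a}) = μ.real C := by
  rw [← measureReal_biUnion_finset]
  · congr 1
    ext x
    simp
  · exact fun a _ b _ hab => Set.disjoint_left.2 fun x hxa hxb => hab (hxa.2.symm.trans hxb.2)
  · exact fun a _ => hC.inter (measurableSet_eval_eq s a)

theorem measurableSet_cylinderSet {S : Finset (Fin d → ℤ)} (w : S → A) :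
    MeasurableSet (cylinderSet w) := by
  simp only [cylinderSet, Set.ofPred_forall]
  exact MeasurableSet.iInter fun s => measurableSet_eval_eq s.1 (w s)

/-- The configuration of shape `S` of a point. -/
def pattern (S : Finset (Fin d → ℤ)) (x : FullShift d A) : S → A := fun s => x s

theorem preimage_pattern_singleton {S : Finset (Fin d → ℤ)} (w : S → A) :
    pattern S ⁻¹' {w} = cylinderSet w := by
  ext x
  exact funext_iff

theorem measure_ext_of_cylinderSet [Finite A] {μ ν : Measure (FullShift d A)} [IsFiniteMeasure ν]
    (h : ∀ (S : Finset (Fin d → ℤ)) (w : S → A), μ (cylinderSet w) = ν (cylinderSet w)) :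
    μ = ν := by
  let _ : MeasurableSpace A := ⊤
  have hpattern (S : Finset (Fin d → ℤ)) : Measurable (pattern S : FullShift d A → S → A) :=
    measurable_pi_lambda _ fun s => measurable_eval s.1
  have hmap (S : Finset (Fin d → ℤ)) : μ.map (pattern S) = ν.map (pattern S) := by
    refine Measure.ext_of_singleton fun w => ?_
    rw [Measure.map_apply (hpattern S) (measurableSet_singleton w),
      Measure.map_apply (hpattern S) (measurableSet_singleton w), preimage_pattern_singleton, h]
  have hfinite (S : Finset (Fin d → ℤ)) : IsFiniteMeasure (ν.map (pattern S)) :=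
    Measure.isFiniteMeasure_map ν _
  exact IsProjectiveLimit.unique (α := fun _ : Fin d → ℤ => A)
    (P := fun S => ν.map (pattern S)) hmap fun _ => rfl

end FullShift

section BlockLaw

variable {A : Type} {n : ℕ}

theorem block_eq_iff_mem_cylinderSet {n : Fin 1 → ℕ} {x : FullShift 1 A} {w : Fin (n 0) → A} :
    block (n 0) x = w ↔ x ∈ cylinderSet (w ∘ (boxEquiv n).symm) := by
  rw [funext_iff, (boxEquiv n).forall_congr_left]
  refine forall_congr' fun s => ?_
  rw [show block (n 0) x ((boxEquiv n).symm s) = x (boxEquiv n ((boxEquiv n).symm s)) from rfl,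
    Equiv.apply_symm_apply]
  rfl

theorem measurableSet_block_eq (w : Fin n → A) :
    MeasurableSet {x : FullShift 1 A | block n x = w} := by
  simp only [block_eq_iff_mem_cylinderSet (n := fun _ => n)]
  exact FullShift.measurableSet_cylinderSet _

theorem block_eq_snoc_iff {x : FullShift 1 A} {w : Fin n → A} {b : A} :
    block (n + 1) x = Fin.snoc w b ↔ block n x = w ∧ x (fun _ => (n : ℤ) + 1) = b := by
  rw [show block (n + 1) x = Fin.snoc (block n x) (x fun _ => (n : ℤ) + 1) from
    (Fin.snoc_init_self _).symm, Fin.snoc_inj]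

theorem block_eq_cons_iff {x : FullShift 1 A} {w : Fin n → A} {a : A} :
    block (n + 1) x = Fin.cons a w ↔
      block n (FullShift.shift (fun _ => 1) x) = w ∧ x (fun _ => 1) = a := by
  have htail : Fin.tail (block (n + 1) x) = block n (FullShift.shift (fun _ => 1) x) :=
    funext fun i => congrArg x (funext fun _ => by simp)
  rw [← htail, ← Fin.cons_self_tail (block (n + 1) x), Fin.cons_inj, and_comm]
  rfl

theorem exists_pattern_eq_block_shift (S : Finset (Fin 1 → ℤ)) :
    ∃ (n : ℕ) (t : Fin 1 → ℤ) (g : (Fin n → A) → S → A),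
      ∀ x : FullShift 1 A, x.pattern S = g (block n (FullShift.shift t x)) := by
  obtain ⟨N, hN⟩ := (S.image fun s => (s 0).natAbs).bddAbove
  have hbound (s : S) : (s.1 0).natAbs ≤ N := hN (Finset.mem_image_of_mem _ s.2)
  refine ⟨2 * N + 1, fun _ => -(N + 1), fun w s => w ⟨(s.1 0 + N).toNat, ?_⟩,
    fun x => funext fun s => congrArg x (funext fun j => ?_)⟩
  · have := hbound s
    omega
  · have := hbound s
    simp only [Subsingleton.elim j 0, Pi.add_apply]
    omega

variable [Fintype A]

/-- The law of the blocks under a shift-invariant probability measure. -/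
noncomputable def blockLaw (μ : Measure (FullShift 1 A)) [IsProbabilityMeasure μ]
    (hμ : ∀ t, MeasurePreserving (FullShift.shift t) μ μ) : StationaryLaw A where
  prob n w := μ.real {x | block n x = w}
  nonneg _ _ := measureReal_nonneg
  prob_zero w := by simp [Subsingleton.elim _ w]
  sum_snoc n w := by
    rw [← FullShift.sum_measureReal_inter_eval (measurableSet_block_eq w) fun _ => (n : ℤ) + 1]
    exact Finset.sum_congr rfl fun b _ => congrArg μ.real (Set.ext fun x => block_eq_snoc_iff)
  sum_cons n w := by
    rw [← (hμ fun _ => 1).measureReal_preimage (measurableSet_block_eq w).nullMeasurableSet,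
      ← FullShift.sum_measureReal_inter_eval
        ((hμ fun _ => 1).measurable (measurableSet_block_eq w)) fun _ => 1]
    exact Finset.sum_congr rfl fun a _ => congrArg μ.real (Set.ext fun x => block_eq_cons_iff)

variable {μ ν : Measure (FullShift 1 A)} [IsProbabilityMeasure μ] [IsProbabilityMeasure ν]
  (hμ : ∀ t, MeasurePreserving (FullShift.shift t) μ μ)
  (hν : ∀ t, MeasurePreserving (FullShift.shift t) ν ν)

theorem measureEntropy_eq_entropyRate_blockLaw :
    measureEntropy μ = (blockLaw μ hμ).entropyRate := by
  refine Tendsto.limUnder_eq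
    (((blockLaw μ hμ).tendsto_blockEntropy_div.comp (tendsto_apply_atTop 0)).congr fun n => ?_)
  rw [Function.comp_apply, Fin.prod_univ_one]
  congr 1
  refine Fintype.sum_equiv ((boxEquiv n).arrowCongr (Equiv.refl A)) _ _ fun w => ?_
  exact congrArg (fun C => Real.negMulLog (μ.real C))
    (Set.ext fun x => block_eq_iff_mem_cylinderSet)

theorem follows_of_pair_blockLaw_pos {X : Set (FullShift 1 A)} (hX : μ Xᶜ = 0) {a b : A}
    (hab : 0 < (blockLaw μ hμ).pair a b) : Follows X a b := by
  by_contra hF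
  have hsub : {x : FullShift 1 A | block 2 x = ![a, b]} ⊆ Xᶜ := fun x hx hxX =>
    hF ⟨x, hxX, fun _ => 1, congrFun hx 0,
      (congrArg x (const_add_single_one 1)).trans (congrFun hx 1)⟩
  exact hab.ne' ((measureReal_eq_zero_iff).2 (measure_mono_null hsub hX))

theorem measure_eq_of_blockLaw_eq
    (h : ∀ n w, (blockLaw μ hμ).prob n w = (blockLaw ν hν).prob n w) : μ = ν := by
  let _ : MeasurableSpace A := ⊤
  have hblock (n : ℕ) : Measurable (block n : FullShift 1 A → Fin n → A) :=
    measurable_pi_lambda _ fun i => FullShift.measurable_eval _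
  have hmap (n : ℕ) : μ.map (block n) = ν.map (block n) := by
    refine Measure.ext_of_singleton fun w => ?_
    rw [Measure.map_apply (hblock n) (measurableSet_singleton w),
      Measure.map_apply (hblock n) (measurableSet_singleton w)]
    exact (measureReal_eq_measureReal_iff).1 (h n w)
  refine FullShift.measure_ext_of_cylinderSet fun S w => ?_
  obtain ⟨n, t, g, hg⟩ := exists_pattern_eq_block_shift (A := A) S
  have hcylinder : (cylinderSet w : Set (FullShift 1 A)) =
      FullShift.shift t ⁻¹' (block n ⁻¹' (g ⁻¹' {w})) := by
    rw [← FullShift.preimage_pattern_singleton, funext hg]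
    rfl
  have hmeas : MeasurableSet (g ⁻¹' {w}) := (Set.toFinite _).measurableSet
  rw [hcylinder, (hμ t).measure_preimage (hblock n hmeas).nullMeasurableSet,
    (hν t).measure_preimage (hblock n hmeas).nullMeasurableSet,
    ← Measure.map_apply (hblock n) hmeas, ← Measure.map_apply (hblock n) hmeas, hmap]

end BlockLaw

section Components

variable {A : Type} {X : Set (FullShift 1 A)} {a b c : A} {n : ℕ}

theorem IsNearestNeighborSFT.mem_iff (hX : IsNearestNeighborSFT X) {x : FullShift 1 A} :
    x ∈ X ↔ ∀ v, Follows X (x v) (x (v + Pi.single 0 1)) := by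
  refine ⟨fun hx v => ⟨x, hx, v, rfl, rfl⟩, fun h => ?_⟩
  obtain ⟨-, F, hF⟩ := hX
  rw [hF]
  intro i v
  obtain ⟨y, hy, u, hyu, hyu'⟩ := h v
  rw [hF] at hy
  rw [Subsingleton.elim i 0, ← hyu, ← hyu']
  exact hy 0 u

theorem IsNearestNeighborSFT.mapsTo_shift (hX : IsNearestNeighborSFT X) (t : Fin 1 → ℤ) :
    Set.MapsTo (FullShift.shift t) X X := by
  intro x hx
  rw [hX.mem_iff] at hx ⊢
  intro v
  simpa only [FullShift.shift, add_right_comm] using hx (v + t)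

theorem communicates_iff :
    Communicates X a b ↔ TransGen (RecurrentEdge (Follows X)) a b :=
  transGen_recurrentEdge_iff.symm

theorem Communicates.trans (hab : Communicates X a b) (hbc : Communicates X b c) :
    Communicates X a c :=
  ⟨hab.1.trans hbc.1, hbc.2.trans hab.2⟩

theorem communicates_self_of_recurrentEdge (hab : RecurrentEdge (Follows X) a b) :
    Communicates X a a :=
  communicates_iff.2 (.head' hab (reflTransGen_recurrentEdge_symm hab))

theorem Communicates.exists_recurrentEdge_right (hab : Communicates X a b) :
    ∃ c, Communicates X a c ∧ RecurrentEdge (Follows X) b c := by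
  have hbb : Communicates X b b := ⟨hab.2.trans hab.1, hab.2.trans hab.1⟩
  obtain ⟨c, hbc, -⟩ := TransGen.head'_iff.1 (communicates_iff.1 hbb)
  exact ⟨c, communicates_iff.2 ((communicates_iff.1 hab).tail hbc), hbc⟩

theorem Communicates.exists_recurrentEdge_left (hab : Communicates X a b) :
    ∃ c, Communicates X a c ∧ RecurrentEdge (Follows X) c b := by
  have hbb : Communicates X b b := ⟨hab.2.trans hab.1, hab.2.trans hab.1⟩
  obtain ⟨c, hbc, hcb⟩ := TransGen.tail'_iff.1 (communicates_iff.1 hbb)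
  exact ⟨c, communicates_iff.2 ((communicates_iff.1 hab).trans_left hbc), hcb⟩

/-- The set of the points of `X` all of whose letters communicate with `a`, an irreducible component
if `a` communicates with itself. -/
def componentOf (X : Set (FullShift 1 A)) (a : A) : Set (FullShift 1 A) :=
  {x ∈ X | ∀ v, Communicates X a (x v)}

theorem mapsTo_shift_componentOf (hX : IsNearestNeighborSFT X) (t : Fin 1 → ℤ) :
    Set.MapsTo (FullShift.shift t) (componentOf X a) (componentOf X a) :=
  fun _ hx => ⟨hX.mapsTo_shift t hx.1, fun v => hx.2 (v + t)⟩

theorem exists_mem_componentOf_block_eq (hX : IsNearestNeighborSFT X) {w : Fin (n + 1) → A}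
    (hw0 : Communicates X a (w 0))
    (hw : ∀ i : Fin n, RecurrentEdge (Follows X) (w i.castSucc) (w i.succ)) :
    ∃ x ∈ componentOf X a, block (n + 1) x = w := by
  have hwa (i : Fin (n + 1)) : Communicates X a (w i) := by
    induction i using Fin.induction with
    | zero => exact hw0
    | succ i ih => exact communicates_iff.2 ((communicates_iff.1 ih).tail (hw i))
  obtain ⟨u, hu, huw⟩ := exists_nat_path_extending
    (R := fun b c : {b // Communicates X a b} => RecurrentEdge (Follows X) b c)
    (fun b => let ⟨c, hac, hbc⟩ := b.2.exists_recurrentEdge_right; ⟨⟨c, hac⟩, hbc⟩)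
    (fun i => ⟨w i, hwa i⟩) hw
  obtain ⟨z, hz, hzu⟩ := exists_int_path_extending
    (R := fun b c : {b // Communicates X a b} => RecurrentEdge (Follows X) b c)
    (fun b => let ⟨c, hac, hcb⟩ := b.2.exists_recurrentEdge_left; ⟨⟨c, hac⟩, hcb⟩) u hu
  refine ⟨fun s => z (s 0 - 1), ⟨hX.mem_iff.2 fun v => ?_, fun v => (z _).2⟩, funext fun i => ?_⟩
  · have hv : (v + Pi.single 0 1 : Fin 1 → ℤ) 0 - 1 = v 0 - 1 + 1 := by simp
    rw [hv]
    exact (hz _).1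
  · simp only [block, add_sub_cancel_right, hzu, huw]

theorem componentOf_nonempty (hX : IsNearestNeighborSFT X) (ha : Communicates X a a) :
    (componentOf X a).Nonempty :=
  let ⟨x, hx, _⟩ := exists_mem_componentOf_block_eq hX (w := fun _ : Fin 1 => a) ha fun i => i.elim0
  ⟨x, hx⟩

theorem componentOf_ne (hX : IsNearestNeighborSFT X) (ha : Communicates X a a)
    (hca : ¬ Communicates X c a) : componentOf X a ≠ componentOf X c := by
  intro heq
  obtain ⟨x, hx⟩ := componentOf_nonempty hX ha
  have hax : Communicates X a (x 0) := hx.2 0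
  have hcx : Communicates X c (x 0) := (heq ▸ hx : x ∈ componentOf X c).2 0
  exact hca (hcx.trans hax.symm)

variable [Fintype A]

theorem image_block_componentOf (hX : IsNearestNeighborSFT X) (a : A) (n : ℕ) :
    block (n + 1) '' componentOf X a =
      graphPaths (RecurrentEdge (Follows X)) {b | Communicates X a b} n := by
  ext w
  rw [SetLike.mem_coe, mem_graphPaths]
  constructor
  · rintro ⟨x, hx, rfl⟩
    refine ⟨hx.2 _, fun i => ⟨?_, ((hx.2 _).2.trans (hx.2 _).1).to_reflTransGen⟩⟩
    exact ⟨x, hx.1, fun _ => i + 1, rfl, congrArg x (const_add_single_one _)⟩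
  · rintro ⟨hw0, hw⟩
    exact exists_mem_componentOf_block_eq hX hw0 hw

variable {lam r : A → ℝ}

theorem topologicalEntropy_componentOf (hX : IsNearestNeighborSFT X)
    (h : IsPerronPair (adjacencyMatrix (RecurrentEdge (Follows X))) lam r)
    (ha : Communicates X a a) : topologicalEntropy (componentOf X a) = Real.log (lam a) := by
  obtain ⟨b, -, hab⟩ := ha.exists_recurrentEdge_right
  have hlam : 0 < lam a := h.eigenvalue_pos adjacencyMatrix_nonneg (adjacencyMatrix_pos_iff.2 hab)
  have hconst : ∀ b ∈ {b | Communicates X a b}, lam b = lam a := fun b hb => by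
    induction communicates_iff.1 hb with
    | single hab => exact (h.lam_eq _ _ (adjacencyMatrix_pos_iff.2 hab)).symm
    | tail hab hbc ih =>
      exact (h.lam_eq _ _ (adjacencyMatrix_pos_iff.2 hbc)).symm.trans
        (ih (communicates_iff.2 hab))
  obtain ⟨k, K, hk, hbounds⟩ := h.exists_card_graphPaths_bounds hconst ⟨a, ha⟩
  have hshift (k : ℝ) (n : ℕ) : k / lam a * lam a ^ (n + 1) = k * lam a ^ n := by
    rw [pow_succ]
    field_simp
  refine topologicalEntropy_eq_of_tendsto
    (tendsto_log_div_natCast (c := k / lam a) (C := K / lam a) (by positivity) hlam ?_ ?_)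
  all_goals
    refine eventually_atTop.2 ⟨1, fun m hm => ?_⟩
    obtain ⟨n, rfl⟩ := Nat.exists_eq_add_of_le' hm
    rw [image_block_componentOf hX, Set.ncard_coe_finset, hshift]
  exacts [(hbounds n).1, (hbounds n).2]

variable {μ ν : Measure (FullShift 1 A)} [IsProbabilityMeasure μ] [IsProbabilityMeasure ν]

namespace IsMeasureOfMaximalEntropy

theorem entropyRate_blockLaw (hμ : IsMeasureOfMaximalEntropy X μ) :
    (blockLaw μ hμ.invariant).entropyRate = topologicalEntropy X := by
  rw [← hμ.entropy_eq, measureEntropy_eq_entropyRate_blockLaw hμ.invariant]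

theorem recurrentEdge_of_pair_blockLaw_pos (hμ : IsMeasureOfMaximalEntropy X μ)
    (hab : 0 < (blockLaw μ hμ.invariant).pair a b) : RecurrentEdge (Follows X) a b :=
  StationaryLaw.recurrentEdge_of_pair_pos _
    (fun _ _ => follows_of_pair_blockLaw_pos hμ.invariant hμ.supported) hab

theorem dominatesEigenvalues_blockLaw (hμ : IsMeasureOfMaximalEntropy X μ)
    (hX : IsNearestNeighborSFT X)
    (h : IsPerronPair (adjacencyMatrix (RecurrentEdge (Follows X))) lam r) :
    (blockLaw μ hμ.invariant).DominatesEigenvalues (RecurrentEdge (Follows X)) lam := by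
  intro a b hab
  have ha := communicates_self_of_recurrentEdge hab
  rw [hμ.entropyRate_blockLaw, ← topologicalEntropy_componentOf hX h ha]
  exact topologicalEntropy_mono (componentOf_nonempty hX ha) (mapsTo_shift_componentOf hX)
    hX.mapsTo_shift fun x hx => hx.1

theorem exists_topologicalEntropy_componentOf_eq (hμ : IsMeasureOfMaximalEntropy X μ)
    (hX : IsNearestNeighborSFT X) :
    ∃ c, Communicates X c c ∧ topologicalEntropy (componentOf X c) = topologicalEntropy X := by
  obtain ⟨lam, r, h⟩ := exists_isPerronPair_adjacencyMatrix
    (G := RecurrentEdge (Follows X)) fun _ _ => reflTransGen_recurrentEdge_symm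
  let p := blockLaw μ hμ.invariant
  obtain ⟨c, hc⟩ : ∃ c, 0 < p.letter c := by
    by_contra! hle
    exact ((Finset.sum_nonpos fun a _ => hle a).trans_lt one_pos).ne p.sum_letter
  obtain ⟨b, hcb⟩ := p.exists_pair_pos_of_letter_pos hc
  have hcc := communicates_self_of_recurrentEdge (hμ.recurrentEdge_of_pair_blockLaw_pos hcb)
  refine ⟨c, hcc, ?_⟩
  rw [topologicalEntropy_componentOf hX h hcc, ← hμ.entropyRate_blockLaw]
  exact p.log_eigenvalue_eq_entropyRate h (fun _ _ => hμ.recurrentEdge_of_pair_blockLaw_pos)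
    (hμ.dominatesEigenvalues_blockLaw hX h) hc

theorem eq_of_unique_component (hμ : IsMeasureOfMaximalEntropy X μ)
    (hν : IsMeasureOfMaximalEntropy X ν) (hX : IsNearestNeighborSFT X)
    (hc : ∀ a, Communicates X a a → topologicalEntropy (componentOf X a) = topologicalEntropy X →
      Communicates X c a) : μ = ν := by
  obtain ⟨lam, r, h⟩ := exists_isPerronPair_adjacencyMatrix
    (G := RecurrentEdge (Follows X)) fun _ _ => reflTransGen_recurrentEdge_symm
  refine measure_eq_of_blockLaw_eq hμ.invariant hν.invariant
    (StationaryLaw.prob_eq_of_unique_maximal_class h (fun _ _ => reflTransGen_recurrentEdge_symm)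
      (fun _ _ => hμ.recurrentEdge_of_pair_blockLaw_pos)
      (fun _ _ => hν.recurrentEdge_of_pair_blockLaw_pos)
      (hμ.entropyRate_blockLaw.trans hν.entropyRate_blockLaw.symm)
      (hμ.dominatesEigenvalues_blockLaw hX h) (c := c) fun a b hab hla => ?_)
  have haa := communicates_self_of_recurrentEdge hab
  refine (communicates_iff.1 (hc a haa ?_)).to_reflTransGen
  rw [topologicalEntropy_componentOf hX h haa, hla, hμ.entropyRate_blockLaw]

end IsMeasureOfMaximalEntropy

theorem exists_two_components_of_hasMultipleMME (hX : IsNearestNeighborSFT X)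
    (hM : HasMultipleMME X) :
    ∃ a c, Communicates X a a ∧ Communicates X c c ∧ ¬ Communicates X c a ∧
      topologicalEntropy (componentOf X a) = topologicalEntropy X ∧
      topologicalEntropy (componentOf X c) = topologicalEntropy X := by
  obtain ⟨μ, ν, hμ, hν, hne⟩ := hM
  have := hμ.isProbabilityMeasure
  have := hν.isProbabilityMeasure
  obtain ⟨c, hcc, hc⟩ := hμ.exists_topologicalEntropy_componentOf_eq hX
  contrapose! hne
  exact hμ.eq_of_unique_component hν hX fun a haa ha => by_contra fun hca =>
    hne a c haa hcc hca ha hc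

theorem log_two_add_le_log_card {S T : Set A} {h : ℝ} (hST : Disjoint S T) (hS : S.Nonempty)
    (hT : T.Nonempty) (hhS : h ≤ Real.log S.ncard) (hhT : h ≤ Real.log T.ncard) :
    Real.log 2 + h ≤ Real.log (Fintype.card A) := by
  have hpos {U : Set A} (hU : U.Nonempty) : (0 : ℝ) < U.ncard :=
    Nat.cast_pos.2 ((Set.ncard_pos (Set.toFinite _)).2 hU)
  rw [Real.le_log_iff_exp_le (hpos hS)] at hhS
  rw [Real.le_log_iff_exp_le (hpos hT)] at hhT
  have hcard : (S.ncard : ℝ) + T.ncard ≤ Fintype.card A := by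
    rw [← Nat.cast_add, ← Set.ncard_union_eq hST, ← Nat.card_eq_fintype_card]
    exact Nat.cast_le.2 (Set.ncard_le_card _)
  rw [Real.le_log_iff_exp_le ((hpos hS).trans_le (le_of_add_le_of_nonneg_left hcard (hpos hT).le)),
    Real.exp_add, Real.exp_log two_pos]
  linarith

theorem two_components_of_hasMultipleMME (hX : IsNearestNeighborSFT X) (hM : HasMultipleMME X) :
    (∃ Y Z : Set (FullShift 1 A), IsIrreducibleComponent X Y ∧ IsIrreducibleComponent X Z ∧
      Y ≠ Z ∧ topologicalEntropy Y = topologicalEntropy X ∧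
      topologicalEntropy Z = topologicalEntropy X) ∧
    Real.log (Fintype.card A) - topologicalEntropy X ≥ Real.log 2 := by
  obtain ⟨a, c, haa, hcc, hca, ha, hc⟩ := exists_two_components_of_hasMultipleMME hX hM
  refine ⟨⟨componentOf X a, componentOf X c, ⟨a, haa, rfl⟩, ⟨c, hcc, rfl⟩,
    componentOf_ne hX haa hca, ha, hc⟩, ?_⟩
  have hle {e : A} (he : Communicates X e e) :
      topologicalEntropy (componentOf X e) ≤ Real.log {b | Communicates X e b}.ncard :=
    topologicalEntropy_le_log_ncard (componentOf_nonempty hX he) (mapsTo_shift_componentOf hX)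
      fun x hx => hx.2
  have hdisj : Disjoint {b | Communicates X a b} {b | Communicates X c b} :=
    Set.disjoint_left.2 fun b hab hcb => hca (Communicates.trans hcb hab.symm)
  exact le_sub_iff_add_le.2 (log_two_add_le_log_card hdisj ⟨a, haa⟩ ⟨c, hcc⟩
    (ha.symm.trans_le (hle haa)) (hc.symm.trans_le (hle hcc)))

end Components

/-- The law of independent letters of law `κ`, one at each site. -/
noncomputable def bernoulliMeasure (d : ℕ) {A : Type} (κ : PMF A) : Measure (FullShift d A) :=
  @Measure.infinitePi (Fin d → ℤ) (fun _ => A) (fun _ => ⊤) fun _ => @PMF.toMeasure A ⊤ κ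

section Bernoulli

variable {d : ℕ} {A : Type} {κ : PMF A}

instance : IsProbabilityMeasure (bernoulliMeasure d κ) :=
  let _ : MeasurableSpace A := ⊤
  inferInstanceAs (IsProbabilityMeasure (Measure.infinitePi fun _ : Fin d → ℤ => κ.toMeasure))

theorem bernoulliMeasure_pi (s : Finset (Fin d → ℤ)) (T : (Fin d → ℤ) → Set A) :
    bernoulliMeasure d κ {x | ∀ i ∈ s, x i ∈ T i} = ∏ i ∈ s, κ.toOuterMeasure (T i) := by
  let _ : MeasurableSpace A := ⊤
  refine (Measure.infinitePi_pi (fun _ : Fin d → ℤ => κ.toMeasure) fun _ _ => trivial).trans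
    (Finset.prod_congr rfl fun i _ => κ.toMeasure_apply_eq_toOuterMeasure_apply trivial)

theorem measurePreserving_shift_bernoulliMeasure (t : Fin d → ℤ) :
    MeasurePreserving (FullShift.shift t) (bernoulliMeasure d κ) (bernoulliMeasure d κ) := by
  let _ : MeasurableSpace A := ⊤
  refine ⟨FullShift.measurable_shift t,
    Measure.eq_infinitePi (fun _ : Fin d → ℤ => κ.toMeasure) fun s T hT => ?_⟩
  have hpreimage : FullShift.shift t ⁻¹' {x | ∀ i ∈ s, x i ∈ T i} =
      {x | ∀ i ∈ s.map (Equiv.addRight t).toEmbedding, x i ∈ T (i - t)} := by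
    ext x
    rw [Set.mem_ofPred_eq, Finset.forall_mem_map]
    simp [FullShift.shift]
  refine (Measure.map_apply (FullShift.measurable_shift t)
    (MeasurableSet.pi s.countable_toSet fun i _ => hT i)).trans
    ((congrArg (bernoulliMeasure d κ) hpreimage).trans ?_)
  rw [bernoulliMeasure_pi, Finset.prod_map]
  simp [κ.toMeasure_apply_eq_toOuterMeasure_apply]

theorem bernoulliMeasure_cylinderSet {S : Finset (Fin d → ℤ)} (w : S → A) :
    bernoulliMeasure d κ (cylinderSet w) = ∏ s, κ (w s) := by
  have hcylinder : cylinderSet w = {x | ∀ i ∈ S, x i ∈ {a | ∀ h : i ∈ S, a = w ⟨i, h⟩}} := by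
    ext x
    simp +contextual [cylinderSet]
  rw [hcylinder, bernoulliMeasure_pi, ← Finset.prod_coe_sort]
  refine Finset.prod_congr rfl fun s _ => ?_
  rw [← κ.toOuterMeasure_apply_singleton]
  congr 1
  ext a
  simp

theorem bernoulliMeasure_compl_fullSubshift {T : Set A} (hT : κ.support ⊆ T) :
    bernoulliMeasure d κ (fullSubshift d T)ᶜ = 0 := by
  have hcompl : (fullSubshift d T)ᶜ =
      ⋃ v, {x : FullShift d A | ∀ i ∈ ({v} : Finset (Fin d → ℤ)), x i ∈ Tᶜ} := by
    ext x
    simp [fullSubshift]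
  rw [hcompl]
  refine measure_iUnion_null fun v => ?_
  rw [bernoulliMeasure_pi, Finset.prod_singleton, PMF.toOuterMeasure_apply_eq_zero_iff]
  exact Set.disjoint_compl_right_iff_subset.2 hT

end Bernoulli

section BernoulliEntropy

theorem negMulLog_prod {ι : Type*} [Fintype ι] [DecidableEq ι] (x : ι → ℝ) :
    Real.negMulLog (∏ j, x j) = ∑ i, ∏ j, if j = i then Real.negMulLog (x j) else x j := by
  have hfactor (i : ι) : (∏ j, if j = i then Real.negMulLog (x j) else x j) =
      (∏ j, x j) * -Real.log (x i) := by
    have hite (j : ι) : (if j = i then Real.negMulLog (x j) else x j) =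
        x j * if j = i then -Real.log (x j) else 1 := by
      split_ifs <;> simp [Real.negMulLog]
    rw [Finset.prod_congr rfl fun j _ => hite j, Finset.prod_mul_distrib, Finset.prod_ite_eq',
      if_pos (Finset.mem_univ i)]
  rw [Finset.sum_congr rfl fun i _ => hfactor i, ← Finset.mul_sum, Finset.sum_neg_distrib]
  rcases eq_or_ne (∏ j, x j) 0 with h0 | h0
  · simp [h0]
  · rw [Real.negMulLog, Real.log_prod fun i hi => Finset.prod_ne_zero_iff.1 h0 i hi]
    ring

variable {d : ℕ} {A : Type} [Fintype A] {κ : PMF A}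

theorem sum_negMulLog_prod {ι : Type*} [Fintype ι] [DecidableEq ι] {f : A → ℝ}
    (hf : ∑ a, f a = 1) :
    ∑ w : ι → A, Real.negMulLog (∏ i, f (w i)) =
      Fintype.card ι * ∑ a, Real.negMulLog (f a) := by
  have hterm (i : ι) :
      (∑ w : ι → A, ∏ j, if j = i then Real.negMulLog (f (w j)) else f (w j)) =
        ∑ a, Real.negMulLog (f a) := by
    rw [← Fintype.prod_sum fun j a => if j = i then Real.negMulLog (f a) else f a]
    have hite (j : ι) : (∑ a, if j = i then Real.negMulLog (f a) else f a) =
        if j = i then ∑ a, Real.negMulLog (f a) else 1 := by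
      split_ifs
      exacts [rfl, hf]
    rw [Finset.prod_congr rfl fun j _ => hite j, Finset.prod_ite_eq', if_pos (Finset.mem_univ i)]
  rw [Finset.sum_congr rfl fun w _ => negMulLog_prod _, Finset.sum_comm,
    Finset.sum_congr rfl fun i _ => hterm i, Finset.sum_const, Finset.card_univ, nsmul_eq_mul]

theorem measureEntropy_bernoulliMeasure :
    measureEntropy (bernoulliMeasure d κ) = ∑ a, Real.negMulLog (κ a).toReal := by
  have hsum : ∑ a, (κ a).toReal = 1 := by
    rw [← ENNReal.toReal_sum fun a _ => κ.apply_ne_top a, ← ENNReal.toReal_one, ← κ.tsum_coe,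
      tsum_fintype]
  refine Tendsto.limUnder_eq (tendsto_const_nhds.congr' ?_)
  filter_upwards [eventually_ge_atTop 1] with n hn
  have hcard : Fintype.card (box n) = ∏ i, n i := by
    rw [Fintype.card_coe, box, Fintype.card_piFinset]
    simp
  simp only [measureReal_def, bernoulliMeasure_cylinderSet, ENNReal.toReal_prod]
  rw [sum_negMulLog_prod hsum, hcard, Nat.cast_prod, mul_div_cancel_left₀]
  exact Finset.prod_ne_zero_iff.2 fun i _ => Nat.cast_ne_zero.2 (Nat.one_le_iff_ne_zero.1 (hn i))

theorem measureEntropy_bernoulliMeasure_uniformOfFinset {s : Finset A} (hs : s.Nonempty) :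
    measureEntropy (bernoulliMeasure d (PMF.uniformOfFinset s hs)) = Real.log s.card := by
  have hcard : (s.card : ℝ) ≠ 0 := Nat.cast_ne_zero.2 hs.card_ne_zero
  classical
  have hterm (a : A) : Real.negMulLog (PMF.uniformOfFinset s hs a).toReal =
      if a ∈ s then Real.negMulLog (s.card : ℝ)⁻¹ else 0 := by
    split_ifs with ha <;> simp [PMF.uniformOfFinset_apply, ha]
  rw [measureEntropy_bernoulliMeasure, Finset.sum_congr rfl fun a _ => hterm a,
    Finset.sum_ite_mem, Finset.univ_inter, Finset.sum_const, nsmul_eq_mul, Real.negMulLog,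
    Real.log_inv]
  field_simp

end BernoulliEntropy

theorem isMeasureOfMaximalEntropy_bernoulliMeasure {d : ℕ} {A : Type} [Fintype A]
    {X : Set (FullShift d A)} {S : Finset A} (hS : S.Nonempty) (hSX : fullSubshift d S ⊆ X)
    (hX : topologicalEntropy X = Real.log S.card) :
    IsMeasureOfMaximalEntropy X (bernoulliMeasure d (PMF.uniformOfFinset S hS)) where
  isProbabilityMeasure := inferInstance
  invariant := measurePreserving_shift_bernoulliMeasure
  supported := measure_mono_null (Set.compl_subset_compl.2 hSX)
    (bernoulliMeasure_compl_fullSubshift (PMF.support_uniformOfFinset hS).subset)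
  entropy_eq := by rw [measureEntropy_bernoulliMeasure_uniformOfFinset, hX]

section UnionFullSubshift

variable {A : Type} {S T : Set A}

theorem mem_iff_of_forall_mem_succ_iff {x : FullShift 1 A}
    (hx : ∀ v, x v ∈ S ↔ x (v + Pi.single 0 1) ∈ S) (v : Fin 1 → ℤ) : x v ∈ S ↔ x 0 ∈ S := by
  have hstep (k : ℤ) : (x fun _ => k) ∈ S ↔ (x fun _ => k + 1) ∈ S :=
    const_add_single_one k ▸ hx fun _ => k
  have hconst (k : ℤ) : (x fun _ => k) ∈ S ↔ (x fun _ => 0) ∈ S := by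
    induction k using Int.induction_on with
    | zero => rfl
    | succ k ih => rw [← hstep, ih]
    | pred k ih => rw [← ih, hstep (-(k : ℤ) - 1), sub_add_cancel]
  rw [show v = fun _ => v 0 from funext fun j => by rw [Subsingleton.elim j 0], hconst]
  rfl

theorem isNearestNeighborSFT_union_fullSubshift (hST : Disjoint S T) (hS : S.Nonempty) :
    IsNearestNeighborSFT (fullSubshift 1 S ∪ fullSubshift 1 T) := by
  obtain ⟨a, ha⟩ := hS
  refine ⟨⟨fun _ => a, Or.inl fun _ => ha⟩, fun _ => (S ×ˢ S ∪ T ×ˢ T)ᶜ, Set.ext fun x => ?_⟩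
  simp only [Set.mem_ofPred_eq, Set.notMem_compl_iff]
  constructor
  · rintro (hx | hx) i v
    exacts [Or.inl ⟨hx _, hx _⟩, Or.inr ⟨hx _, hx _⟩]
  · intro hx
    have hstep (v : Fin 1 → ℤ) : x v ∈ S ↔ x (v + Pi.single 0 1) ∈ S := by
      rcases hx 0 v with ⟨h, h'⟩ | ⟨h, h'⟩
      · exact iff_of_true h h'
      · exact iff_of_false (hST.notMem_of_mem_right h) (hST.notMem_of_mem_right h')
    by_cases h0 : x 0 ∈ S
    · exact Or.inl fun v => (mem_iff_of_forall_mem_succ_iff hstep v).2 h0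
    · refine Or.inr fun v => ((hx 0 v).resolve_left fun h => h0 ?_).1
      exact (mem_iff_of_forall_mem_succ_iff hstep v).1 h.1

theorem topologicalEntropy_union_fullSubshift [Finite A] (hS : S.Nonempty) (hT : T.Nonempty)
    (hcard : S.ncard = T.ncard) :
    topologicalEntropy (fullSubshift 1 S ∪ fullSubshift 1 T) = Real.log S.ncard := by
  have hpos : (0 : ℝ) < S.ncard := Nat.cast_pos.2 ((Set.ncard_pos (Set.toFinite _)).2 hS)
  refine topologicalEntropy_eq_of_tendsto (tendsto_log_div_natCast (c := 1) (C := 2) one_pos hpos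
    (.of_forall fun n => ?_) (.of_forall fun n => ?_))
  · rw [one_mul, ← Nat.cast_pow, ← ncard_image_block_fullSubshift hS]
    exact Nat.cast_le.2 (Set.ncard_le_ncard (Set.image_mono Set.subset_union_left)
      (Set.toFinite _))
  · have hle := Set.ncard_union_le (block n '' fullSubshift 1 S) (block n '' fullSubshift 1 T)
    rw [← Set.image_union, ncard_image_block_fullSubshift hS, ncard_image_block_fullSubshift hT,
      ← hcard, ← two_mul] at hle
    exact_mod_cast hle

theorem hasMultipleMME_union_fullSubshift [Fintype A] {S T : Finset A} (hST : Disjoint S T)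
    (hS : S.Nonempty) (hT : T.Nonempty) (hcard : S.card = T.card) :
    HasMultipleMME (fullSubshift 1 (S : Set A) ∪ fullSubshift 1 (T : Set A)) := by
  have hentropy := topologicalEntropy_union_fullSubshift (S := (S : Set A)) (T := T) hS hT
    (by simpa only [Set.ncard_coe_finset] using hcard)
  rw [Set.ncard_coe_finset] at hentropy
  refine ⟨bernoulliMeasure 1 (PMF.uniformOfFinset S hS),
    bernoulliMeasure 1 (PMF.uniformOfFinset T hT),
    isMeasureOfMaximalEntropy_bernoulliMeasure hS Set.subset_union_left hentropy,
    isMeasureOfMaximalEntropy_bernoulliMeasure hT Set.subset_union_right (hcard ▸ hentropy),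
    fun heq => ?_⟩
  have hnullS := bernoulliMeasure_compl_fullSubshift (d := 1)
    (PMF.support_uniformOfFinset hS).subset
  have hnullT := bernoulliMeasure_compl_fullSubshift (d := 1)
    (PMF.support_uniformOfFinset hT).subset
  have hnull := measure_union_null hnullS (heq ▸ hnullT)
  have huniv : (fullSubshift 1 (S : Set A))ᶜ ∪ (fullSubshift 1 (T : Set A))ᶜ = Set.univ :=
    Set.eq_univ_of_forall fun x => not_and_or.1 fun hx =>
      Finset.disjoint_left.1 hST (hx.1 0) (hx.2 0)
  rw [huniv, measure_univ] at hnull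
  exact one_ne_zero hnull

end UnionFullSubshift

section TwoFullShifts

variable {n : ℕ}

theorem twoFullShifts_eq_union_fullSubshift (n : ℕ) : twoFullShifts n =
    fullSubshift 1 (Finset.univ.map Function.Embedding.inl : Finset (Fin n ⊕ Fin n)) ∪
      fullSubshift 1 (Finset.univ.map Function.Embedding.inr : Finset (Fin n ⊕ Fin n)) := by
  ext x
  simp [twoFullShifts, fullSubshift, eq_comm]

theorem isNearestNeighborSFT_twoFullShifts (hn : 1 ≤ n) :
    IsNearestNeighborSFT (twoFullShifts n) := by
  have : NeZero n := ⟨Nat.one_le_iff_ne_zero.1 hn⟩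
  rw [twoFullShifts_eq_union_fullSubshift]
  exact isNearestNeighborSFT_union_fullSubshift
    (Finset.disjoint_coe.2 (Finset.disjoint_map_inl_map_inr _ _)) Finset.univ_nonempty.map

theorem hasMultipleMME_twoFullShifts (hn : 1 ≤ n) : HasMultipleMME (twoFullShifts n) := by
  have : NeZero n := ⟨Nat.one_le_iff_ne_zero.1 hn⟩
  rw [twoFullShifts_eq_union_fullSubshift]
  exact hasMultipleMME_union_fullSubshift (Finset.disjoint_map_inl_map_inr _ _)
    Finset.univ_nonempty.map Finset.univ_nonempty.map (by simp only [Finset.card_map])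

theorem log_card_sub_topologicalEntropy_twoFullShifts (hn : 1 ≤ n) :
    Real.log (Fintype.card (Fin n ⊕ Fin n)) - topologicalEntropy (twoFullShifts n) =
      Real.log 2 := by
  have : NeZero n := ⟨Nat.one_le_iff_ne_zero.1 hn⟩
  have hn0 : (n : ℝ) ≠ 0 := NeZero.ne _
  rw [twoFullShifts_eq_union_fullSubshift,
    topologicalEntropy_union_fullSubshift Finset.univ_nonempty.map Finset.univ_nonempty.map
      (by simp only [Set.ncard_coe_finset, Finset.card_map]), Set.ncard_coe_finset,
    Finset.card_map, Finset.card_univ, Fintype.card_sum, Fintype.card_fin, ← two_mul,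
    Nat.cast_mul, Nat.cast_two, Real.log_mul two_ne_zero hn0, add_sub_cancel_right]

end TwoFullShifts

theorem theorem5p2 :
    alphaCrit 1 = Real.log 2 ∧
    (∀ (A : Type) [Fintype A] (X : Set (FullShift 1 A)),
      IsNearestNeighborSFT X → HasMultipleMME X →
        (∃ Y Z : Set (FullShift 1 A), IsIrreducibleComponent X Y ∧ IsIrreducibleComponent X Z ∧
          Y ≠ Z ∧ topologicalEntropy Y = topologicalEntropy X ∧
          topologicalEntropy Z = topologicalEntropy X) ∧
        Real.log (Fintype.card A) - topologicalEntropy X ≥ Real.log 2) ∧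
    (∀ n : ℕ, 1 ≤ n →
      IsNearestNeighborSFT (twoFullShifts n) ∧ HasMultipleMME (twoFullShifts n) ∧
        Real.log (Fintype.card (Fin n ⊕ Fin n)) - topologicalEntropy (twoFullShifts n) =
          Real.log 2) := by
  refine ⟨?_, fun A _ X hX hM => two_components_of_hasMultipleMME hX hM, fun n hn =>
    ⟨isNearestNeighborSFT_twoFullShifts hn, hasMultipleMME_twoFullShifts hn,
      log_card_sub_topologicalEntropy_twoFullShifts hn⟩⟩
  refine IsLeast.csInf_eq ⟨⟨Fin 1 ⊕ Fin 1, inferInstance, twoFullShifts 1,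
    isNearestNeighborSFT_twoFullShifts le_rfl, hasMultipleMME_twoFullShifts le_rfl, ?_⟩, ?_⟩
  · have := log_card_sub_topologicalEntropy_twoFullShifts (n := 1) le_rfl
    linarith
  · rintro α ⟨A, _, X, hX, hM, hα⟩
    have := (two_components_of_hasMultipleMME hX hM).2
    linarith
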